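/- Theorem 1.1 (property C). For $a>0$ let $Q_a$ be the set of real-valued functions $q$ on $\mathbb{R}^3$ with $q\in L^2(B_a)$, where $B_a=\{x\in\mathbb{R}^3: |x|<a\}$, and $q(x)=0$ for $|x|>a$. Let $q_1,q_2\in Q_a$, let $k\ge 0$ be fixed, and let $D\subset\mathbb{R}^3$ be a bounded open set. For $j=1,2$ put $L_j=-\nabla^2+q_j$, and let $N_j$ be the set of functions $w:D\to\mathbb{C}$ with $w,\;q_jw\in L^1_{\mathrm{loc}}(D)$ that satisfy $(L_j-k^2)w=0$ in $D$ in the sense of distributions. Then the pair $\{L_1-k^2,\,L_2-k^2\}$ has property $C$: for every $p\in[1,\infty]$, with conjugate exponent $p'=p/(p-1)$ ($p'=\infty$ if $p=1$, $p'=1$ if $p=\infty$), if $f\in L^p(D)$ (complex-valued) satisfies $$\int_D f(x)\,w_1(x)\,w_2(x)\,dx=0\quad\text{for all } w_1\in N_1,\ w_2\in N_2 \text{ with } w_1w_2\in L^{p'}(D),$$ then $f=0$ almost everywhere in $D$. -/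

import Mathlib

open MeasureTheory TopologicalSpace
open scoped ENNReal Distributions Laplacian

/-- Euclidean three-space. -/
abbrev R3 : Type := EuclideanSpace ℝ (Fin 3)

/-- The class of real-valued potentials in `L²(B_a)` that vanish for `|x| > a`. -/
def Qa (a : ℝ) : Set (R3 → ℝ) :=
  {q | MemLp q 2 (volume.restrict (Metric.ball 0 a)) ∧ ∀ x, a < ‖x‖ → q x = 0}

/-- The functions `w` on `D` that solve `(-∇² + q - k²) w = 0` in `D` in the sense of
distributions. The two local integrability conditions say that `w` and `q w` are
(regular) distributions on `D`; the equation is tested against all complex-valued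
`φ ∈ C_c^∞(D)`. Values of `w` outside `D` play no role. -/
def schrodingerSolutions (q : R3 → ℝ) (k : ℝ) (D : Opens R3) : Set (R3 → ℂ) :=
  {w | LocallyIntegrableOn w D ∧
    LocallyIntegrableOn (fun x => (q x : ℂ) * w x) D ∧
    ∀ φ : 𝓓(D, ℂ),
      ∫ x in (D : Set R3), w x * (-(Δ (φ : R3 → ℂ) x) + ((q x : ℂ) - (k : ℂ) ^ 2) * φ x) = 0}

/-- Property `C_p` on `D` for a pair of operators with solution sets `N₁`, `N₂` in `D`: a function
`f ∈ L^p(D)` that is orthogonal to all products `w₁ w₂ ∈ L^{p'}(D)` of elements of `N₁` and `N₂`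
vanishes. Here `p'` is the conjugate exponent (`p' = ∞` if `p = 1`, `p' = 1` if `p = ∞`). -/
def HasPropertyCp (N₁ N₂ : Set (R3 → ℂ)) (D : Opens R3) (p : ℝ≥0∞) : Prop :=
  ∀ f : R3 → ℂ, MemLp f p (volume.restrict (D : Set R3)) →
    (∀ w₁ ∈ N₁, ∀ w₂ ∈ N₂,
      MemLp (fun x => w₁ x * w₂ x) p.conjExponent (volume.restrict (D : Set R3)) →
      ∫ x in (D : Set R3), f x * (w₁ x * w₂ x) = 0) →
    f =ᵐ[volume.restrict (D : Set R3)] 0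

/-- Property `C`: property `C_p` for all `1 ≤ p ≤ ∞`. -/
def HasPropertyC (N₁ N₂ : Set (R3 → ℂ)) (D : Opens R3) : Prop :=
  ∀ p : ℝ≥0∞, 1 ≤ p → HasPropertyCp N₁ N₂ D p

/-! Fix ξ, an orthonormal basis b with ξ = 2r b₂, and t, s with s² + r² = t² + k². The vectors θ₁ =
t b₀ + i(s b₁ + r b₂) and θ₂ = -t b₀ + i(-s b₁ + r b₂) satisfy θ·θ = -k² and add up to iξ. If w_j =
exp(θ_j·x)(1 + R_j) are solutions with |R_j| ≤ δ ≤ 1, the exponential growth cancels in w₁w₂, which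
is bounded and hence lies in every L^{p'}(D). Orthogonality then gives |∫ f exp(iξ·x)| ≤ 3δ ∫|f|.
Letting δ → 0, the Fourier transform of f vanishes (f is integrable because D is bounded), so f = 0.

The work is to make R_j uniformly small for potentials that are only in L². Put D inside a period
cell and expand the remainder over a lattice of frequencies shifted by half a step along b₀, where
the symbol σ of the conjugated operator has no zeros. In three dimensions ∑ |σ|⁻² is finite and
tends to 0 as |t| → ∞ (`exists_tsum_inv_latticeSymbolSq_le`). By Parseval and Cauchy–Schwarz,
division by σ maps L² into absolutely convergent Fourier series with small norm, while
multiplication by q maps bounded continuous functions into L². The composite is a contraction in the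
sup norm (`exists_gridSeries_solution`), and its fixed point yields a distributional solution
(`mem_schrodingerSolutions_of_gridSeries`). -/

/-! ### Pointwise lower bounds for the symbol -/

/-- A Young-type inequality: (9/8)/4 + (5/4)/2 = 29/32 < 1, so it suffices to compare V² with X and
replace the smaller by the larger. -/
theorem rpow_mul_rpow_le_pow_add_sq {V X : ℝ} (hV : 1 ≤ V) (hX : 1 ≤ X) :
    V ^ (9 / 8 : ℝ) * X ^ (5 / 4 : ℝ) ≤ V ^ 4 + X ^ 2 := by
  have hV0 : 0 ≤ V := by linarith
  have hX0 : 0 ≤ X := by linarith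
  rcases le_total (V ^ 2) X with h | h
  · have h1 : V ^ (9 / 8 : ℝ) ≤ X ^ (3 / 4 : ℝ) := by
      calc V ^ (9 / 8 : ℝ) ≤ V ^ (2 * (3 / 4) : ℝ) :=
            Real.rpow_le_rpow_of_exponent_le hV (by norm_num)
        _ = (V ^ 2) ^ (3 / 4 : ℝ) := by rw [Real.rpow_mul hV0]; norm_cast
        _ ≤ X ^ (3 / 4 : ℝ) := Real.rpow_le_rpow (by positivity) h (by norm_num)
    calc V ^ (9 / 8 : ℝ) * X ^ (5 / 4 : ℝ) ≤ X ^ (3 / 4 : ℝ) * X ^ (5 / 4 : ℝ) := by gcongr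
      _ = X ^ 2 := by
          rw [← Real.rpow_add (by linarith)]; norm_num
      _ ≤ _ := by linarith [pow_nonneg hV0 4]
  · have h1 : X ^ (5 / 4 : ℝ) ≤ V ^ (5 / 2 : ℝ) := by
      calc X ^ (5 / 4 : ℝ) ≤ (V ^ 2) ^ (5 / 4 : ℝ) := Real.rpow_le_rpow hX0 h (by norm_num)
        _ = V ^ (2 * (5 / 4) : ℝ) := by rw [Real.rpow_mul hV0]; norm_cast
        _ = V ^ (5 / 2 : ℝ) := by norm_num
    calc V ^ (9 / 8 : ℝ) * X ^ (5 / 4 : ℝ) ≤ V ^ (9 / 8 : ℝ) * V ^ (5 / 2 : ℝ) := by gcongr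
      _ = V ^ (29 / 8 : ℝ) := by
          rw [← Real.rpow_add (by linarith)]; norm_num
      _ ≤ V ^ (4 : ℝ) := Real.rpow_le_rpow_of_exponent_le hV (by norm_num)
      _ = V ^ 4 := by norm_cast
      _ ≤ _ := by linarith [pow_nonneg hX0 2]

/-- Lower bound for the symbol where the squared frequency is at most `2 ρ²`. -/
theorem symbol_lower_bound_near {ε : ℝ} (hε : 0 < ε) {t x y z N : ℝ} (ht : 1 ≤ t)
    (htε : 1 ≤ t * ε) (hx : ε / 2 ≤ |x|) (hN : N ≤ 2 * t ^ 2)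
    (h : x ^ 2 + y ^ 2 + z ^ 2 ≤ 2 * N) {v : ℝ}
    (hv : v = |y| - √(N - x ^ 2 - z ^ 2)) :
    t ^ (1 / 8 : ℝ) * ((1 + |x|) * (1 + |v|) * (1 + |z|)) ^ (9 / 8 : ℝ) ≤
      200 * (1 + 2 / ε) ^ 2 * ((x ^ 2 + y ^ 2 + z ^ 2 - N) ^ 2 + 4 * t ^ 2 * x ^ 2) := by
  set A := x ^ 2 + y ^ 2 + z ^ 2 - N with hA
  have hvA : v ^ 4 ≤ A ^ 2 := by
    -- With w the square root, A = (|y| - w)(|y| + w) and the second factor dominates |v|. If the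
    -- radicand is nonpositive, then w = 0 and A ≥ y².
    have : v ^ 2 ≤ |A| := by
      rcases le_total 0 (N - x ^ 2 - z ^ 2) with h0 | h0
      · have hs := Real.sq_sqrt h0
        have hs0 := Real.sqrt_nonneg (N - x ^ 2 - z ^ 2)
        set w := √(N - x ^ 2 - z ^ 2)
        have e : A = (|y| - w) * (|y| + w) := by
          have := sq_abs y
          rw [hA]; linear_combination hs - this
        rw [e, hv, abs_mul, ← sq_abs (|y| - w), sq]
        refine mul_le_mul_of_nonneg_left ?_ (abs_nonneg _)
        rw [abs_of_nonneg (add_nonneg (abs_nonneg y) hs0), abs_le]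
        constructor <;> linarith [abs_nonneg y]
      · rw [Real.sqrt_eq_zero_of_nonpos h0] at hv
        rw [hv, sub_zero, sq_abs]
        exact le_trans (by linarith) (le_abs_self A)
    calc v ^ 4 = (v ^ 2) ^ 2 := by ring
      _ ≤ |A| ^ 2 := by gcongr
      _ = A ^ 2 := sq_abs A
  set c := 1 + 2 / ε with hc
  have hc1 : 1 ≤ c := by rw [hc]; linarith [show 0 < 2 / ε by positivity]
  have hM : 1 + |x| ≤ c * |x| := by
    have : 1 ≤ 2 / ε * |x| := by
      calc (1 : ℝ) = 2 / ε * (ε / 2) := by field_simp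
        _ ≤ _ := by gcongr
    rw [hc]; linarith
  have hz : 1 + |z| ≤ 4 * t := by
    have : |z| ≤ 2 * t := abs_le_of_sq_le_sq (by nlinarith [sq_nonneg x, sq_nonneg y]) (by linarith)
    linarith
  -- Since |z| ≤ 2t here, the z-weight costs only t^(9/8); with the gain t^(1/8) this is the t^(5/4)
  -- contained in X^(5/4).
  have h2 := rpow_mul_rpow_le_pow_add_sq (V := 1 + |v|) (X := t * (1 + |x|))
    (by linarith [abs_nonneg v]) (by nlinarith [abs_nonneg x])
  have hX : t * (1 + |x|) ≤ c * (t * |x|) := by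
    have := mul_le_mul_of_nonneg_left hM (by linarith : 0 ≤ t)
    linarith
  have hV : (1 + |v|) ^ 4 ≤ 8 * (1 + v ^ 4) := by
    have : v ^ 4 = |v| ^ 4 := by rw [Even.pow_abs (by decide)]
    rw [this]
    have h1 : (1 + |v|) ^ 2 ≤ 2 * (1 + |v| ^ 2) := by linarith [sq_nonneg (|v| - 1)]
    calc (1 + |v|) ^ 4 = ((1 + |v|) ^ 2) ^ 2 := by ring
      _ ≤ (2 * (1 + |v| ^ 2)) ^ 2 := by gcongr
      _ ≤ _ := by linarith [sq_nonneg (|v| ^ 2 - 1)]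
  have hB : 1 ≤ 4 * t ^ 2 * x ^ 2 := by
    rw [← sq_abs x]
    have : 1 ≤ 2 * (t * |x|) := by
      have := mul_le_mul_of_nonneg_left hx (by linarith : 0 ≤ t)
      linarith
    calc (1 : ℝ) ≤ (2 * (t * |x|)) ^ 2 := one_le_pow₀ this
      _ = _ := by ring
  have h3 : (1 + |v|) ^ 4 + (t * (1 + |x|)) ^ 2 ≤ 16 * c ^ 2 * (A ^ 2 + 4 * t ^ 2 * x ^ 2) := by
    have : (t * (1 + |x|)) ^ 2 ≤ (c * (t * |x|)) ^ 2 := by gcongr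
    have e : (c * (t * |x|)) ^ 2 = c ^ 2 * (t ^ 2 * x ^ 2) := by rw [mul_pow, mul_pow, sq_abs]
    rw [e] at this
    have hc2 : 1 ≤ c ^ 2 := one_le_pow₀ hc1
    have h5 : 0 ≤ t ^ 2 * x ^ 2 := by positivity
    have h6 : 8 * (A ^ 2 + 4 * t ^ 2 * x ^ 2) ≤ 8 * c ^ 2 * (A ^ 2 + 4 * t ^ 2 * x ^ 2) := by
      exact mul_le_mul_of_nonneg_right (by linarith) (by positivity)
    have h7 : 0 ≤ c ^ 2 * A ^ 2 := by positivity
    have h8 : 0 ≤ c ^ 2 * (t ^ 2 * x ^ 2) := by positivity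
    linarith
  have hx0 := abs_nonneg x
  have hv0 := abs_nonneg v
  have hz0 := abs_nonneg z
  have h4 : (4 : ℝ) ^ (9 / 8 : ℝ) ≤ 8 := by
    calc (4 : ℝ) ^ (9 / 8 : ℝ) ≤ (4 : ℝ) ^ (3 / 2 : ℝ) :=
          Real.rpow_le_rpow_of_exponent_le (by norm_num) (by norm_num)
      _ = (2 ^ (2 : ℝ)) ^ (3 / 2 : ℝ) := by norm_num
      _ = 8 := by rw [← Real.rpow_mul (by norm_num)]; norm_num
  calc t ^ (1 / 8 : ℝ) * ((1 + |x|) * (1 + |v|) * (1 + |z|)) ^ (9 / 8 : ℝ)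
      ≤ t ^ (1 / 8 : ℝ) * ((1 + |x|) * (1 + |v|) * (4 * t)) ^ (9 / 8 : ℝ) := by gcongr
    _ = 4 ^ (9 / 8 : ℝ) * ((1 + |v|) ^ (9 / 8 : ℝ) * (t ^ (5 / 4 : ℝ) * (1 + |x|) ^ (9 / 8 : ℝ))) := by
        rw [Real.mul_rpow (by positivity) (by positivity), Real.mul_rpow (by positivity)
          (by positivity), Real.mul_rpow (by positivity) (by positivity),
          show (5 / 4 : ℝ) = 1 / 8 + 9 / 8 by norm_num, Real.rpow_add (by linarith : 0 < t)]
        ring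
    _ ≤ 8 * ((1 + |v|) ^ (9 / 8 : ℝ) * (t ^ (5 / 4 : ℝ) * (1 + |x|) ^ (5 / 4 : ℝ))) := by
        have hx1 : 1 ≤ 1 + |x| := by linarith
        have h5 : (1 + |x|) ^ (9 / 8 : ℝ) ≤ (1 + |x|) ^ (5 / 4 : ℝ) :=
          Real.rpow_le_rpow_of_exponent_le hx1 (by norm_num)
        refine mul_le_mul h4 ?_ (by positivity) (by norm_num)
        gcongr
    _ = 8 * ((1 + |v|) ^ (9 / 8 : ℝ) * (t * (1 + |x|)) ^ (5 / 4 : ℝ)) := by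
        rw [Real.mul_rpow (by linarith) (by linarith)]
    _ ≤ 8 * (16 * c ^ 2 * (A ^ 2 + 4 * t ^ 2 * x ^ 2)) := 
        mul_le_mul_of_nonneg_left (h2.trans h3) (by norm_num)
    _ ≤ _ := by
        have : 0 ≤ c ^ 2 * (A ^ 2 + 4 * t ^ 2 * x ^ 2) := by positivity
        linarith

/-- Lower bound for the symbol where the squared frequency is at least `2 ρ²`. -/
theorem symbol_lower_bound_far {t x y z N : ℝ} (ht : 1 ≤ t) (hN : t ^ 2 ≤ N)
    (h : 2 * N ≤ x ^ 2 + y ^ 2 + z ^ 2) :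
    t ^ (1 / 8 : ℝ) * ((1 + |x|) * (1 + |y|) * (1 + |z|)) ^ (9 / 8 : ℝ) ≤
      200 * ((x ^ 2 + y ^ 2 + z ^ 2 - N) ^ 2 + 4 * t ^ 2 * x ^ 2) := by
  set Y := √(x ^ 2 + y ^ 2 + z ^ 2) with hY
  have hY2 : Y ^ 2 = x ^ 2 + y ^ 2 + z ^ 2 := Real.sq_sqrt (by positivity)
  have hY0 : 0 ≤ Y := Real.sqrt_nonneg _
  have hYt : t ≤ Y := abs_le_of_sq_le_sq' (by nlinarith) hY0 |>.2
  have hY1 : 1 ≤ Y := ht.trans hYt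
  have hx : 1 + |x| ≤ 2 * Y := by
    have : |x| ≤ Y := abs_le_of_sq_le_sq (by nlinarith) hY0
    linarith
  have hy : 1 + |y| ≤ 2 * Y := by
    have : |y| ≤ Y := abs_le_of_sq_le_sq (by nlinarith) hY0
    linarith
  have hz : 1 + |z| ≤ 2 * Y := by
    have : |z| ≤ Y := abs_le_of_sq_le_sq (by nlinarith) hY0
    linarith
  have h8 : (8 : ℝ) ^ (9 / 8 : ℝ) ≤ 16 := by
    calc (8 : ℝ) ^ (9 / 8 : ℝ) ≤ (8 : ℝ) ^ (4 / 3 : ℝ) :=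
          Real.rpow_le_rpow_of_exponent_le (by norm_num) (by norm_num)
      _ = (2 ^ (3 : ℝ)) ^ (4 / 3 : ℝ) := by norm_num
      _ = 16 := by rw [← Real.rpow_mul (by norm_num)]; norm_num
  -- Every factor on the left is controlled by Y, with total exponent 1/8 + 27/8 = 7/2, below the 4
  -- supplied by (Y² - N)² ≥ Y⁴/4.
  calc t ^ (1 / 8 : ℝ) * ((1 + |x|) * (1 + |y|) * (1 + |z|)) ^ (9 / 8 : ℝ)
      ≤ Y ^ (1 / 8 : ℝ) * ((2 * Y) * (2 * Y) * (2 * Y)) ^ (9 / 8 : ℝ) := by gcongr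
    _ = 8 ^ (9 / 8 : ℝ) * (Y ^ (1 / 8 : ℝ) * (Y ^ (9 / 8 : ℝ) * Y ^ (9 / 8 : ℝ) * Y ^ (9 / 8 : ℝ))) := by
        rw [show (2 * Y) * (2 * Y) * (2 * Y) = 8 * (Y * Y * Y) by ring,
          Real.mul_rpow (by positivity) (by positivity), Real.mul_rpow (by positivity)
          (by positivity), Real.mul_rpow (by positivity) (by positivity)]
        ring
    _ = 8 ^ (9 / 8 : ℝ) * Y ^ (7 / 2 : ℝ) := by
        rw [← Real.rpow_add (by linarith), ← Real.rpow_add (by linarith),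
          ← Real.rpow_add (by linarith)]
        norm_num
    _ ≤ 16 * Y ^ (4 : ℝ) := by gcongr; norm_num
    _ = 16 * Y ^ 4 := by norm_cast
    _ ≤ _ := by
        rw [← hY2] at h ⊢
        have h5 : 0 ≤ t ^ 2 * x ^ 2 := by positivity
        have h6 : Y ^ 2 / 2 ≤ Y ^ 2 - N := by linarith
        have h7 : (Y ^ 2 / 2) ^ 2 ≤ (Y ^ 2 - N) ^ 2 := by gcongr
        nlinarith

/-! ### Lattice sums of the inverse symbol -/

/-- The one-dimensional weight `(1 + |x|)^(-9/8)`. -/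
noncomputable def latticeWeight (x : ℝ) : ℝ≥0∞ := ENNReal.ofReal ((1 + |x|) ^ (-(9 / 8) : ℝ))

/-- Uniformity in s holds because translating the index by ⌊s/ε⌋ reduces to a shift in [0, ε], where
one convergent series dominates. -/
theorem exists_tsum_latticeWeight_le {ε : ℝ} (hε : 0 < ε) :
    ∃ C : ℝ≥0∞, C ≠ ∞ ∧ ∀ s : ℝ, ∑' n : ℤ, latticeWeight (ε * n + s) ≤ C := by
  set c := (ε / (1 + 2 * ε)) with hc
  have hc0 : 0 < c := by positivity
  have hsum : Summable fun n : ℤ => (c * (1 + |(n : ℝ)|)) ^ (-(9 / 8) : ℝ) := by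
    have h := (Real.summable_abs_int_rpow (b := 9 / 8) (by norm_num)).mul_left (c ^ (-(9 / 8) : ℝ))
    refine Summable.of_norm_bounded_eventually (g := _) h ?_
    have : ∀ᶠ n : ℤ in Filter.cofinite, n ≠ 0 := by
      simpa using (Set.finite_singleton (0 : ℤ)).compl_mem_cofinite
    filter_upwards [this] with n hn
    have hn' : 0 < |(n : ℝ)| := by positivity
    rw [Real.norm_of_nonneg (by positivity), Real.mul_rpow (by positivity) (by positivity)]
    exact mul_le_mul_of_nonneg_left
      (Real.rpow_le_rpow_of_nonpos hn' (by linarith) (by norm_num)) (by positivity)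
  refine ⟨_, hsum.tsum_ofReal_ne_top, fun s => ?_⟩
  set k : ℤ := ⌊s / ε⌋ with hk
  have hs1 : ε * k ≤ s := by
    have := Int.floor_le (s / ε)
    rw [le_div_iff₀ hε] at this
    linarith
  have hs2 : s ≤ ε * k + ε := by
    have := (Int.lt_floor_add_one (s / ε)).le
    rw [div_le_iff₀ hε] at this
    linarith
  rw [← (Equiv.subRight k).tsum_eq]
  refine ENNReal.tsum_le_tsum fun n => ENNReal.ofReal_le_ofReal ?_
  refine Real.rpow_le_rpow_of_nonpos (by positivity) ?_ (by norm_num)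
  rw [hc, div_mul_eq_mul_div, div_le_iff₀ (by positivity)]
  simp only [Equiv.subRight_apply, Int.cast_sub]
  set e := s - ε * k with he
  have e1 : ε * (n - k : ℝ) + s = ε * n + e := by rw [he]; ring
  rw [e1]
  have h1 : ε * |(n : ℝ)| ≤ |ε * n + e| + ε := by
    have : |ε * n| ≤ |ε * n + e| + |e| := by
      calc |ε * n| = |(ε * n + e) - e| := by ring_nf
        _ ≤ _ := abs_sub _ _
    rw [abs_mul, abs_of_pos hε, abs_of_nonneg (by linarith : 0 ≤ e)] at this
    linarith
  nlinarith [abs_nonneg (ε * n + e)]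

theorem ofReal_inv_le_latticeWeight {K t x v z S : ℝ} (hK : 0 < K) (ht : 0 < t)
    (h : t ^ (1 / 8 : ℝ) * ((1 + |x|) * (1 + |v|) * (1 + |z|)) ^ (9 / 8 : ℝ) ≤ K * S) :
    ENNReal.ofReal S⁻¹ ≤ ENNReal.ofReal (K * t ^ (-(1 / 8) : ℝ)) *
      (latticeWeight x * latticeWeight v * latticeWeight z) := by
  have hx0 := abs_nonneg x
  have hv0 := abs_nonneg v
  have hz0 := abs_nonneg z
  unfold latticeWeight
  rw [← ENNReal.ofReal_mul (by positivity), ← ENNReal.ofReal_mul (by positivity),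
    ← ENNReal.ofReal_mul (by positivity)]
  refine ENNReal.ofReal_le_ofReal ?_
  rw [← Real.mul_rpow (by positivity) (by positivity), ← Real.mul_rpow (by positivity)
    (by positivity), Real.rpow_neg (by positivity), Real.rpow_neg (by positivity)]
  set p := ((1 + |x|) * (1 + |v|) * (1 + |z|)) ^ (9 / 8 : ℝ) with hp
  have hp0 : 0 < p := by positivity
  have ht0 : 0 < t ^ (1 / 8 : ℝ) := by positivity
  have hS : 0 < S := by
    by_contra! hS
    nlinarith [mul_pos ht0 hp0]
  rw [inv_le_iff_one_le_mul₀ hS]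
  calc 1 = (t ^ (1 / 8 : ℝ) * p) * ((t ^ (1 / 8 : ℝ))⁻¹ * p⁻¹) := by field_simp
    _ ≤ (K * S) * ((t ^ (1 / 8 : ℝ))⁻¹ * p⁻¹) := by gcongr
    _ = _ := by ring

/-- The squared modulus of the symbol of the conjugated Helmholtz operator at the half-shifted
lattice point `ε (n₀ + 1/2, n₁, n₂)`. -/
noncomputable def latticeSymbolSq (ε t s r : ℝ) (n : Fin 3 → ℤ) : ℝ :=
  ((ε * n 0 + ε / 2) ^ 2 + (ε * n 1 + s) ^ 2 + (ε * n 2 + r) ^ 2 - (s ^ 2 + r ^ 2)) ^ 2 +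
    4 * t ^ 2 * (ε * n 0 + ε / 2) ^ 2

/-- This is the purpose of the half shift: the imaginary part 2tx of the symbol stays at least |t|ε
in modulus on the lattice. -/
theorem half_le_abs_int_add_half {ε : ℝ} (hε : 0 < ε) (m : ℤ) : ε / 2 ≤ |ε * m + ε / 2| := by
  rcases le_or_gt 0 m with h | h
  · have : (0 : ℝ) ≤ m := by exact_mod_cast h
    exact le_trans (by nlinarith) (le_abs_self _)
  · have : (m : ℝ) ≤ -1 := by exact_mod_cast Int.le_sub_one_of_lt h
    exact le_trans (by nlinarith) (neg_le_abs _)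

theorem latticeSymbolSq_pos {ε t : ℝ} (hε : 0 < ε) (ht : t ≠ 0) (s r : ℝ) (n : Fin 3 → ℤ) :
    0 < latticeSymbolSq ε t s r n := by
  have h := half_le_abs_int_add_half hε (n 0)
  have h1 : ε * n 0 + ε / 2 ≠ 0 := by
    intro h0
    rw [h0, abs_zero] at h
    linarith
  unfold latticeSymbolSq
  positivity

theorem latticeWeight_abs_sub_le (y τ : ℝ) :
    latticeWeight (|y| - τ) ≤ latticeWeight (y - τ) + latticeWeight (y + τ) := by
  rcases abs_choice y with h | h <;> rw [h]
  · exact le_self_add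
  · have : latticeWeight (-y - τ) = latticeWeight (y + τ) := by
      unfold latticeWeight
      rw [← abs_neg, neg_sub, sub_neg_eq_add, add_comm τ y]
    rw [this]
    exact le_add_self

/-- The middle coordinate is summed innermost because its shift in the weight depends on the other
two. -/
theorem tsum_fin_three (f : (Fin 3 → ℤ) → ℝ≥0∞) :
    ∑' n, f n = ∑' (a : ℤ) (c : ℤ) (b : ℤ), f ![a, b, c] := by
  let e : ℤ × ℤ × ℤ ≃ (Fin 3 → ℤ) :=
    { toFun := fun p => ![p.1, p.2.2, p.2.1]
      invFun := fun n => (n 0, n 2, n 1)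
      left_inv := fun p => by simp
      right_inv := fun n => by ext i; fin_cases i <;> rfl }
  rw [← e.tsum_eq, ENNReal.tsum_prod']
  exact tsum_congr fun a => ENNReal.tsum_prod'

/-- The pointwise bounds majorize the inverse by |t|^(-1/8) times a product of three summable
weights. The weight centred on the zero set of the real part moves with n 0 and n 2, which is
harmless since the one-dimensional sums are bounded uniformly in the shift. -/
theorem exists_tsum_inv_latticeSymbolSq_le {ε : ℝ} (hε : 0 < ε) (r k : ℝ) {δ : ℝ} (hδ : 0 < δ) :
    ∃ T : ℝ, 0 < T ∧ ∀ t s : ℝ, T ≤ |t| → s ^ 2 + r ^ 2 = t ^ 2 + k ^ 2 →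
      ∑' n : Fin 3 → ℤ, ENNReal.ofReal (latticeSymbolSq ε t s r n)⁻¹ ≤ ENNReal.ofReal δ := by
  obtain ⟨C, hC, hCs⟩ := exists_tsum_latticeWeight_le hε
  set K : ℝ := 200 * (1 + 2 / ε) ^ 2 with hK
  have hK0 : 0 < K := by positivity
  have hK200 : 200 ≤ K := by
    have : 1 ≤ (1 + 2 / ε) ^ 2 := one_le_pow₀ (by linarith [show 0 < 2 / ε by positivity])
    linarith
  have hlim : Filter.Tendsto (fun t : ℝ => K * t ^ (-(1 / 8) : ℝ) * (3 * C.toReal ^ 3))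
      Filter.atTop (nhds (K * 0 * (3 * C.toReal ^ 3))) :=
    ((tendsto_rpow_neg_atTop (by norm_num)).const_mul K).mul_const _
  rw [mul_zero, zero_mul] at hlim
  obtain ⟨T, hT⟩ := Filter.eventually_atTop.1 (hlim.eventually_le_const hδ)
  -- |t| ≥ |k| gives s² + r² ≤ 2t², and |t| ≥ 1/ε lets 4t²x² ≥ 1 absorb additive constants.
  refine ⟨max (max T 1) (max |k| (1 / ε)), by positivity, fun t s ht hs => ?_⟩
  simp only [max_le_iff] at ht
  obtain ⟨⟨htT, ht1⟩, htk, htε⟩ := ht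
  have htε' : 1 ≤ |t| * ε := by rwa [div_le_iff₀ hε] at htε
  have hk2 : k ^ 2 ≤ t ^ 2 := sq_le_sq.2 htk
  have key : ∀ n : Fin 3 → ℤ, ENNReal.ofReal (latticeSymbolSq ε t s r n)⁻¹ ≤
      ENNReal.ofReal (K * |t| ^ (-(1 / 8) : ℝ)) * (latticeWeight (ε * n 0 + ε / 2) *
        (latticeWeight (ε * n 1 + (s - √(s ^ 2 + r ^ 2 - (ε * n 0 + ε / 2) ^ 2 -
          (ε * n 2 + r) ^ 2))) +
        latticeWeight (ε * n 1 + (s + √(s ^ 2 + r ^ 2 - (ε * n 0 + ε / 2) ^ 2 -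
          (ε * n 2 + r) ^ 2))) + latticeWeight (ε * n 1 + s)) *
        latticeWeight (ε * n 2 + r)) := by
    intro n
    have hx := half_le_abs_int_add_half hε (n 0)
    set x := ε * n 0 + ε / 2
    set y := ε * n 1 + s with hy
    set z := ε * n 2 + r
    set τ := √(s ^ 2 + r ^ 2 - x ^ 2 - z ^ 2)
    rw [← add_sub_assoc, ← add_assoc, ← hy]
    change ENNReal.ofReal ((x ^ 2 + y ^ 2 + z ^ 2 - (s ^ 2 + r ^ 2)) ^ 2 + 4 * t ^ 2 * x ^ 2)⁻¹ ≤ _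
    rw [← sq_abs t]
    rcases le_total (x ^ 2 + y ^ 2 + z ^ 2) (2 * (s ^ 2 + r ^ 2)) with h | h
    · refine (ofReal_inv_le_latticeWeight hK0 (by linarith) (symbol_lower_bound_near hε ht1 htε'
        hx (by rw [sq_abs]; linarith) h rfl)).trans ?_
      gcongr
      exact (latticeWeight_abs_sub_le y τ).trans le_self_add
    · refine (ofReal_inv_le_latticeWeight (v := y) hK0 (by linarith)
        ((symbol_lower_bound_far ht1 (by rw [sq_abs]; nlinarith [sq_nonneg k]) h).trans
          (mul_le_mul_of_nonneg_right hK200 (by positivity)))).trans ?_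
      gcongr
      exact le_add_self
  -- The factor 3 counts the centres τ and -τ of the near region and the uncentred weight of the far
  -- region.
  calc _ ≤ _ := ENNReal.tsum_le_tsum key
    _ ≤ ENNReal.ofReal (K * |t| ^ (-(1 / 8) : ℝ)) * (C * (3 * C) * C) := by
        rw [ENNReal.tsum_mul_left, tsum_fin_three]
        gcongr
        simp only [Matrix.cons_val_zero, Matrix.cons_val_one, Matrix.cons_val]
        calc _ ≤ ∑' (a : ℤ) (c : ℤ), latticeWeight (ε * a + ε / 2) * (3 * C) *
              latticeWeight (ε * c + r) := by
              refine ENNReal.tsum_le_tsum fun a => ENNReal.tsum_le_tsum fun c => ?_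
              rw [ENNReal.tsum_mul_right, ENNReal.tsum_mul_left, ENNReal.tsum_add,
                ENNReal.tsum_add]
              gcongr
              calc _ ≤ C + C + C := by gcongr <;> exact hCs _
                _ = 3 * C := by ring
          _ ≤ _ := by
              simp_rw [ENNReal.tsum_mul_left, mul_assoc, ENNReal.tsum_mul_right]
              gcongr <;> exact hCs _
    _ = ENNReal.ofReal (K * |t| ^ (-(1 / 8) : ℝ) * (3 * C.toReal ^ 3)) := by
        rw [ENNReal.ofReal_mul (p := K * _) (by positivity), ENNReal.ofReal_mul (p := 3) (by norm_num),
          ENNReal.ofReal_pow ENNReal.toReal_nonneg, ENNReal.ofReal_toReal hC]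
        rw [show ENNReal.ofReal 3 = 3 by norm_num]
        ring
    _ ≤ _ := ENNReal.ofReal_le_ofReal (hT _ htT)

/-! ### Fourier series on a period cell -/

section Grid

noncomputable local instance : MeasureSpace UnitAddCircle := ⟨AddCircle.haarAddCircle⟩

local instance : Measure.IsAddHaarMeasure (volume : Measure UnitAddCircle) :=
  inferInstanceAs (Measure.IsAddHaarMeasure AddCircle.haarAddCircle)

local instance : IsProbabilityMeasure (volume : Measure UnitAddCircle) :=
  inferInstanceAs (IsProbabilityMeasure AddCircle.haarAddCircle)

open scoped ComplexConjugate InnerProductSpace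

/-- The plane wave with frequency `ε ∑ nᵢ bᵢ`. -/
noncomputable def gridMode (b : OrthonormalBasis (Fin 3) ℝ R3) (ε : ℝ) (n : Fin 3 → ℤ) (x : R3) :
    ℂ :=
  Complex.exp (((ε * ∑ i, n i * ⟪b i, x⟫_ℝ : ℝ) : ℂ) * Complex.I)

/-- A cell of periodicity of all `gridMode b ε n`. -/
def gridCell (b : OrthonormalBasis (Fin 3) ℝ R3) (ε : ℝ) : Set R3 :=
  {x | ∀ i, ε * ⟪b i, x⟫_ℝ ∈ Set.Ioc (-Real.pi) Real.pi}

/-- The Fourier coefficients with respect to `gridMode b ε` and a measure. -/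
noncomputable def gridCoeff (b : OrthonormalBasis (Fin 3) ℝ R3) (ε : ℝ) (ν : Measure R3)
    (F : R3 → ℂ) (n : Fin 3 → ℤ) : ℂ :=
  ∫ x, conj (gridMode b ε n x) * F x ∂ν

theorem continuous_gridMode (b : OrthonormalBasis (Fin 3) ℝ R3) (ε : ℝ) (n : Fin 3 → ℤ) :
    Continuous (gridMode b ε n) := by
  unfold gridMode
  fun_prop

theorem norm_gridMode (b : OrthonormalBasis (Fin 3) ℝ R3) (ε : ℝ) (n : Fin 3 → ℤ) (x : R3) :
    ‖gridMode b ε n x‖ = 1 :=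
  Complex.norm_exp_ofReal_mul_I _

/-- The linear parametrization of space by the coordinates of the grid. -/
noncomputable def gridEquiv (b : OrthonormalBasis (Fin 3) ℝ R3) (ε : ℝ) (hε : 0 < ε) :
    (Fin 3 → ℝ) ≃L[ℝ] R3 :=
  ((EuclideanSpace.equiv (Fin 3) ℝ).symm.trans b.repr.symm.toContinuousLinearEquiv).trans
    (ContinuousLinearEquiv.smulLeft (Units.mk0 (2 * Real.pi / ε) (by positivity)))

theorem inner_gridEquiv (b : OrthonormalBasis (Fin 3) ℝ R3) {ε : ℝ} (hε : 0 < ε) (y : Fin 3 → ℝ)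
    (i : Fin 3) : ε * ⟪b i, gridEquiv b ε hε y⟫_ℝ = 2 * Real.pi * y i := by
  have : gridEquiv b ε hε y = (2 * Real.pi / ε) • b.repr.symm ((EuclideanSpace.equiv (Fin 3) ℝ).symm y) :=
    rfl
  rw [this, inner_smul_right, ← b.repr_apply_apply, LinearIsometryEquiv.apply_symm_apply]
  simp
  field_simp

/-- The section of the torus over the cell of periodicity. -/
noncomputable def gridSection (b : OrthonormalBasis (Fin 3) ℝ R3) (ε : ℝ) (hε : 0 < ε)
    (z : UnitAddTorus (Fin 3)) : R3 :=
  gridEquiv b ε hε (UnitAddTorus.measurableEquivPiIoc (fun _ => -(1 / 2)) z).1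

theorem gridMode_gridSection (b : OrthonormalBasis (Fin 3) ℝ R3) {ε : ℝ} (hε : 0 < ε)
    (n : Fin 3 → ℤ) (z : UnitAddTorus (Fin 3)) :
    gridMode b ε n (gridSection b ε hε z) = UnitAddTorus.mFourier n z := by
  obtain ⟨y, rfl⟩ := (UnitAddTorus.measurableEquivPiIoc (fun _ : Fin 3 => -(1 / 2 : ℝ))).symm.surjective z
  rw [gridSection, MeasurableEquiv.apply_symm_apply, UnitAddTorus.coe_symm_measurableEquivPiIoc_apply,
    gridMode, UnitAddTorus.mFourier]
  simp only [ContinuousMap.coe_mk, fourier_coe_apply]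
  rw [← Complex.exp_sum, Finset.mul_sum]
  have : ∀ i, ε * (n i * ⟪b i, gridEquiv b ε hε y.1⟫_ℝ) = n i * (2 * Real.pi * y.1 i) := by
    intro i
    rw [← inner_gridEquiv b hε]
    ring
  simp only [this]
  push_cast
  rw [Finset.sum_mul]
  congr 1
  refine Finset.sum_congr rfl fun i _ => ?_
  field_simp

/-- By uniqueness of Haar measure a linear isomorphism scales Lebesgue measure by a constant. Only 0
< c < ∞ matters, as c cancels later. -/
theorem exists_measurePreserving_gridSection (b : OrthonormalBasis (Fin 3) ℝ R3) {ε : ℝ}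
    (hε : 0 < ε) : ∃ c : ℝ≥0∞, c ≠ 0 ∧ c ≠ ∞ ∧
      MeasurePreserving (gridSection b ε hε) volume (c • volume.restrict (gridCell b ε)) := by
  set A := gridEquiv b ε hε
  have hS : MeasurableSet {x : Fin 3 → ℝ | ∀ i, x i ∈ Set.Ioc (-(1 / 2) : ℝ) (-(1 / 2) + 1)} :=
    MeasurableSet.univ_pi' fun i => measurableSet_Ioc
  have h1 := (UnitAddTorus.measurePreserving_equivPiIoc (fun _ : Fin 3 => -(1 / 2 : ℝ)))
  have h2 : MeasurePreserving (Subtype.val : {x : Fin 3 → ℝ // ∀ i, x i ∈ Set.Ioc (-(1 / 2) : ℝ)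
      (-(1 / 2) + 1)} → _) (Measure.comap Subtype.val volume)
      (volume.restrict {x : Fin 3 → ℝ | ∀ i, x i ∈ Set.Ioc (-(1 / 2) : ℝ) (-(1 / 2) + 1)}) :=
    ⟨measurable_subtype_coe, map_comap_subtype_coe hS volume⟩
  have hA : Measure.map A volume = (Measure.addHaarScalarFactor (Measure.map A volume) volume) •
      (volume : Measure R3) := Measure.isAddLeftInvariant_eq_smul _ _
  have hpos := Measure.addHaarScalarFactor_pos_of_isAddHaarMeasure (Measure.map A volume)
    (volume : Measure R3)
  set c := Measure.addHaarScalarFactor (Measure.map A volume) (volume : Measure R3)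
  have hcell : A ⁻¹' (gridCell b ε) =
      {x : Fin 3 → ℝ | ∀ i, x i ∈ Set.Ioc (-(1 / 2) : ℝ) (-(1 / 2) + 1)} := by
    ext y
    simp only [gridCell, Set.mem_preimage, Set.mem_ofPred_eq, Set.mem_Ioc, A, inner_gridEquiv b hε]
    refine forall_congr' fun i => ?_
    have := Real.pi_pos
    constructor <;> rintro ⟨h, h'⟩ <;> constructor <;> nlinarith
  have h3 : MeasurePreserving A
      (volume.restrict {x : Fin 3 → ℝ | ∀ i, x i ∈ Set.Ioc (-(1 / 2) : ℝ) (-(1 / 2) + 1)})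
      ((c : ℝ≥0∞) • volume.restrict (gridCell b ε)) := by
    refine ⟨A.continuous.measurable, ?_⟩
    have hr := A.toHomeomorph.measurableEmbedding.restrict_map volume (gridCell b ε)
    rw [ContinuousLinearEquiv.coe_toHomeomorph] at hr
    rw [← hcell, ← hr, hA, Measure.restrict_smul]
    rfl
  exact ⟨c, by exact_mod_cast hpos.ne', ENNReal.coe_ne_top, h3.comp (h2.comp h1)⟩

/-- Parseval's identity for the plane waves of a grid. -/
theorem exists_hasSum_gridCoeff (b : OrthonormalBasis (Fin 3) ℝ R3) {ε : ℝ} (hε : 0 < ε) :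
    ∃ c : ℝ≥0∞, c ≠ 0 ∧ c ≠ ∞ ∧ IsFiniteMeasure (c • volume.restrict (gridCell b ε)) ∧
      ∀ F G : R3 → ℂ, MemLp F 2 (c • volume.restrict (gridCell b ε)) →
        MemLp G 2 (c • volume.restrict (gridCell b ε)) →
        HasSum (fun n => conj (gridCoeff b ε (c • volume.restrict (gridCell b ε)) F n) *
          gridCoeff b ε (c • volume.restrict (gridCell b ε)) G n)
          (∫ x, conj (F x) * G x ∂(c • volume.restrict (gridCell b ε))) := by
  obtain ⟨c, hc0, hc, hmp⟩ := exists_measurePreserving_gridSection b hε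
  set ν := c • volume.restrict (gridCell b ε)
  have hfin : IsFiniteMeasure ν := by
    rw [← hmp.map_eq]
    infer_instance
  refine ⟨c, hc0, hc, hfin, fun F G hF hG => ?_⟩
  have hint : ∀ H : R3 → ℂ, AEStronglyMeasurable H ν →
      ∫ z, H (gridSection b ε hε z) = ∫ x, H x ∂ν := by
    intro H hH
    rw [← hmp.map_eq] at hH ⊢
    exact (integral_map hmp.measurable.aemeasurable hH).symm
  have hF' := hF.comp_measurePreserving hmp
  have hG' := hG.comp_measurePreserving hmp
  have hcoe : ∀ (H : R3 → ℂ) (hH : MemLp H 2 ν) (n : Fin 3 → ℤ),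
      UnitAddTorus.mFourierCoeff ((hH.comp_measurePreserving hmp).toLp _) n = gridCoeff b ε ν H n := by
    intro H hH n
    rw [gridCoeff, ← hint (fun x => conj (gridMode b ε n x) * H x) ((Complex.continuous_conj.comp
      (continuous_gridMode b ε n)).aestronglyMeasurable.mul hH.aestronglyMeasurable)]
    refine integral_congr_ae ?_
    filter_upwards [(hH.comp_measurePreserving hmp).coeFn_toLp] with z hz
    rw [hz, gridMode_gridSection, ← UnitAddTorus.mFourier_neg]
    rfl
  have h := UnitAddTorus.hasSum_prod_mFourierCoeff (hF'.toLp _) (hG'.toLp _)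
  convert h using 1
  · funext n
    exact (congrArg₂ (fun u v => conj u * v) (hcoe F hF n) (hcoe G hG n)).symm
  rw [← hint (fun x => conj (F x) * G x) (((Complex.continuous_conj.comp_aestronglyMeasurable
    hF.aestronglyMeasurable)).mul hG.aestronglyMeasurable)]
  refine integral_congr_ae ?_
  filter_upwards [hF'.coeFn_toLp, hG'.coeFn_toLp] with z hz hz'
  rw [hz, hz']
  rfl

end Grid

/-! ### The periodic integral equation -/

section FixedPoint

open scoped ComplexConjugate InnerProductSpace BoundedContinuousFunction

/-- Cauchy–Schwarz in ℓ². This is how an L² source produces a bounded continuous remainder. -/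
theorem summable_norm_div_and_tsum_le {ι : Type*} {u σ : ι → ℂ} {A δ : ℝ} (hδ : 0 ≤ δ)
    (hu : HasSum (fun n => ‖u n‖ ^ 2) A) (hσ : Summable fun n => (‖σ n‖ ^ 2)⁻¹)
    (hσδ : ∑' n, (‖σ n‖ ^ 2)⁻¹ ≤ δ ^ 2) :
    (Summable fun n => ‖u n / σ n‖) ∧ ∑' n, ‖u n / σ n‖ ≤ δ * √A := by
  have h := Real.summable_and_inner_le_Lp_mul_Lq_tsum_of_nonneg (f := fun n => ‖u n‖)
    (g := fun n => ‖σ n‖⁻¹) Real.HolderConjugate.two_two (fun n => norm_nonneg _)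
    (fun n => by positivity) (by simpa using hu.summable) (by simpa using hσ)
  simp only [Real.rpow_two, ← Real.sqrt_eq_rpow, inv_pow, hu.tsum_eq] at h
  simp only [div_eq_mul_inv, norm_mul, norm_inv]
  refine ⟨h.1, h.2.trans ?_⟩
  rw [mul_comm]
  gcongr
  rw [Real.sqrt_le_left hδ]
  exact hσδ

theorem memLp_ofReal_mul_boundedContinuous {ν : Measure R3} {q : R3 → ℝ} (hq : MemLp q 2 ν)
    (P : R3 →ᵇ ℂ) : MemLp (fun x => (q x : ℂ) * P x) 2 ν := by
  have h1 : MemLp (fun x => (q x : ℂ)) 2 ν := hq.ofReal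
  refine (h1.norm.const_mul ‖P‖).of_le
    (h1.aestronglyMeasurable.mul P.continuous.aestronglyMeasurable) ?_
  refine Filter.Eventually.of_forall fun x => ?_
  rw [norm_mul, norm_mul, norm_norm, norm_norm, mul_comm]
  gcongr
  exact P.norm_coe_le_norm x

theorem sqrt_integral_ofReal_mul_le {ν : Measure R3} {q : R3 → ℝ} (hq : MemLp q 2 ν)
    (P : R3 →ᵇ ℂ) :
    √(∫ x, ‖(q x : ℂ) * P x‖ ^ 2 ∂ν) ≤ ‖P‖ * √(∫ x, q x ^ 2 ∂ν) := by
  rw [← Real.sqrt_sq (norm_nonneg P), ← Real.sqrt_mul (by positivity), ← integral_const_mul]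
  refine Real.sqrt_le_sqrt (integral_mono_of_nonneg (Filter.Eventually.of_forall fun x => by
    positivity) (hq.integrable_sq.const_mul _) (Filter.Eventually.of_forall fun x => ?_))
  simp only [norm_mul, mul_pow, Complex.norm_real, Real.norm_eq_abs, sq_abs]
  rw [mul_comm]
  gcongr
  exact P.norm_coe_le_norm x

/-- `gridMode` as a bounded continuous function. -/
noncomputable def gridModeBCF (b : OrthonormalBasis (Fin 3) ℝ R3) (ε : ℝ) (n : Fin 3 → ℤ) :
    R3 →ᵇ ℂ :=
  BoundedContinuousFunction.ofNormedAddCommGroup (gridMode b ε n) (continuous_gridMode b ε n) 1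
    fun x => (norm_gridMode b ε n x).le

theorem norm_smul_gridModeBCF_le (b : OrthonormalBasis (Fin 3) ℝ R3) (ε : ℝ) (n : Fin 3 → ℤ)
    (u : ℂ) : ‖u • gridModeBCF b ε n‖ ≤ ‖u‖ := by
  rw [norm_smul]
  refine mul_le_of_le_one_right (norm_nonneg u) ?_
  exact BoundedContinuousFunction.norm_ofNormedAddCommGroup_le _ zero_le_one _

theorem summable_smul_gridModeBCF (b : OrthonormalBasis (Fin 3) ℝ R3) (ε : ℝ)
    {u : (Fin 3 → ℤ) → ℂ} (hu : Summable fun n => ‖u n‖) :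
    Summable fun n => u n • gridModeBCF b ε n :=
  Summable.of_norm_bounded hu fun n => norm_smul_gridModeBCF_le b ε n _

theorem norm_tsum_smul_gridModeBCF_le (b : OrthonormalBasis (Fin 3) ℝ R3) (ε : ℝ)
    {u : (Fin 3 → ℤ) → ℂ} (hu : Summable fun n => ‖u n‖) :
    ‖∑' n, u n • gridModeBCF b ε n‖ ≤ ∑' n, ‖u n‖ :=
  tsum_of_norm_bounded hu.hasSum fun n => norm_smul_gridModeBCF_le b ε n _

theorem tsum_smul_gridModeBCF_apply (b : OrthonormalBasis (Fin 3) ℝ R3) (ε : ℝ)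
    {u : (Fin 3 → ℤ) → ℂ} (hu : Summable fun n => ‖u n‖) (x : R3) :
    (∑' n, u n • gridModeBCF b ε n) x = ∑' n, u n * gridMode b ε n x :=
  ((BoundedContinuousFunction.evalCLM ℂ x).map_tsum (summable_smul_gridModeBCF b ε hu))

theorem gridCoeff_sub (b : OrthonormalBasis (Fin 3) ℝ R3) (ε : ℝ) {ν : Measure R3}
    [IsFiniteMeasure ν] {F G : R3 → ℂ} (hF : MemLp F 2 ν) (hG : MemLp G 2 ν) (n : Fin 3 → ℤ) :
    gridCoeff b ε ν (fun x => F x - G x) n = gridCoeff b ε ν F n - gridCoeff b ε ν G n := by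
  have h : ∀ H : R3 → ℂ, MemLp H 2 ν → Integrable (fun x => conj (gridMode b ε n x) * H x) ν :=
    fun H hH => (hH.integrable (by norm_num)).bdd_mul (c := 1)
      (Complex.continuous_conj.comp (continuous_gridMode b ε n)).aestronglyMeasurable
      (Filter.Eventually.of_forall fun x => by simp [norm_gridMode])
  unfold gridCoeff
  rw [← integral_sub (h F hF) (h G hG)]
  simp only [mul_sub]

/-- Solution of the periodic integral equation `P = G (q (E + P))`, where `G` is the Fourier
multiplier with symbol `σ⁻¹`. -/
theorem exists_gridSeries_solution {b : OrthonormalBasis (Fin 3) ℝ R3} {ε : ℝ} {ν : Measure R3}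
    [IsFiniteMeasure ν]
    (hB : ∀ F, MemLp F 2 ν → HasSum (fun n => ‖gridCoeff b ε ν F n‖ ^ 2) (∫ x, ‖F x‖ ^ 2 ∂ν))
    {q : R3 → ℝ} (hq : MemLp q 2 ν) (E : R3 →ᵇ ℂ) (hE : ‖E‖ ≤ 1) {σ : (Fin 3 → ℤ) → ℂ} {δ : ℝ}
    (hδ : 0 ≤ δ) (hσ : Summable fun n => (‖σ n‖ ^ 2)⁻¹) (hσδ : ∑' n, (‖σ n‖ ^ 2)⁻¹ ≤ δ ^ 2)
    (hδq : δ * √(∫ x, q x ^ 2 ∂ν) ≤ 1 / 2) :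
    ∃ u : (Fin 3 → ℤ) → ℂ, (Summable fun n => ‖u n‖) ∧
      ∑' n, ‖u n‖ ≤ 2 * (δ * √(∫ x, q x ^ 2 ∂ν)) ∧
      ∀ n, u n = gridCoeff b ε ν
        (fun x => (q x : ℂ) * (E x + ∑' m, u m * gridMode b ε m x)) n / σ n := by
  set K := √(∫ x, q x ^ 2 ∂ν)
  have hK : 0 ≤ δ * K := mul_nonneg hδ (Real.sqrt_nonneg _)
  have hbd : ∀ P : R3 →ᵇ ℂ,
      (Summable fun n => ‖gridCoeff b ε ν (fun x => (q x : ℂ) * P x) n / σ n‖) ∧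
      ∑' n, ‖gridCoeff b ε ν (fun x => (q x : ℂ) * P x) n / σ n‖ ≤ δ * K * ‖P‖ := by
    intro P
    have h := summable_norm_div_and_tsum_le hδ (hB _ (memLp_ofReal_mul_boundedContinuous hq P)) hσ
      hσδ
    refine ⟨h.1, h.2.trans ?_⟩
    calc _ ≤ δ * (‖P‖ * K) := by
          gcongr
          exact sqrt_integral_ofReal_mul_le hq P
      _ = _ := by ring
  -- Each application passes from sup norm to L² (factor K) to ℓ¹ coefficients (factor δ) and back
  -- to sup norm, so the Lipschitz constant is δK ≤ 1/2.
  let Φ : (R3 →ᵇ ℂ) → (R3 →ᵇ ℂ) := fun P =>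
    ∑' n, (gridCoeff b ε ν (fun x => (q x : ℂ) * (E + P) x) n / σ n) • gridModeBCF b ε n
  have hΦ : ContractingWith (1 / 2) Φ := by
    refine ⟨by norm_num, LipschitzWith.of_dist_le_mul fun P P' => ?_⟩
    have hsub : Φ P - Φ P' = ∑' n, (gridCoeff b ε ν (fun x => (q x : ℂ) * (P - P') x) n / σ n) •
        gridModeBCF b ε n := by
      rw [← (summable_smul_gridModeBCF b ε (hbd _).1).tsum_sub
        (summable_smul_gridModeBCF b ε (hbd _).1)]
      refine tsum_congr fun n => ?_
      rw [← sub_smul, ← sub_div, ← gridCoeff_sub b ε (memLp_ofReal_mul_boundedContinuous hq _)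
        (memLp_ofReal_mul_boundedContinuous hq _)]
      congr 3
      funext x
      simp only [BoundedContinuousFunction.coe_add, BoundedContinuousFunction.coe_sub, Pi.add_apply,
        Pi.sub_apply]
      ring
    rw [dist_eq_norm, dist_eq_norm, hsub]
    refine (norm_tsum_smul_gridModeBCF_le b ε (hbd _).1).trans ((hbd _).2.trans ?_)
    push_cast
    gcongr
  set P := hΦ.fixedPoint Φ
  have hP : Φ P = P := hΦ.fixedPoint_isFixedPt
  set u : (Fin 3 → ℤ) → ℂ := fun n => gridCoeff b ε ν (fun x => (q x : ℂ) * (E + P) x) n / σ n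
    with hu
  have hus := hbd (E + P)
  have hPu : ∑' n, u n • gridModeBCF b ε n = P := hP
  have hP1 : ‖P‖ ≤ δ * K * ‖E + P‖ := by
    calc ‖P‖ = ‖∑' n, u n • gridModeBCF b ε n‖ := by rw [hPu]
      _ ≤ _ := (norm_tsum_smul_gridModeBCF_le b ε hus.1).trans hus.2
  -- ‖E + P‖ ≤ 1 + ½‖E + P‖, and the last term is absorbed.
  have hEP : ‖E + P‖ ≤ 2 := by
    have h1 := norm_add_le E P
    have h2 : δ * K * ‖E + P‖ ≤ 1 / 2 * ‖E + P‖ := by gcongr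
    linarith
  refine ⟨u, hus.1, hus.2.trans ?_, fun n => ?_⟩
  · calc δ * K * ‖E + P‖ ≤ δ * K * 2 := by gcongr
      _ = _ := by ring
  · have : ∀ x, ∑' m, u m * gridMode b ε m x = P x := fun x => by
      rw [← tsum_smul_gridModeBCF_apply b ε hus.1, hPu]
    simp only [this]
    rfl

end FixedPoint

/-! ### Complex exponentials and the Helmholtz operator -/

section PlaneExp

open scoped ComplexConjugate InnerProductSpace

/-- The exponential `exp (ζ · x)` for the complex vector `ζ = α + i β`. -/
noncomputable def planeExp (α β x : R3) : ℂ :=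
  Complex.exp ((⟪α, x⟫_ℝ : ℂ) + (⟪β, x⟫_ℝ : ℂ) * Complex.I)

theorem continuous_planeExp (α β : R3) : Continuous (planeExp α β) := by
  unfold planeExp
  fun_prop

theorem norm_planeExp (α β x : R3) : ‖planeExp α β x‖ = Real.exp ⟪α, x⟫_ℝ := by
  simp [planeExp, Complex.norm_exp]

theorem planeExp_add (α α' β β' x : R3) :
    planeExp (α + α') (β + β') x = planeExp α β x * planeExp α' β' x := by
  unfold planeExp
  rw [← Complex.exp_add, inner_add_left, inner_add_left]
  congr 1
  push_cast
  ring

theorem hasFDerivAt_planeExp (α β x : R3) :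
    HasFDerivAt (planeExp α β) (planeExp α β x • (Complex.ofRealCLM.comp (innerSL ℝ α) +
      (Complex.ofRealCLM.comp (innerSL ℝ β)).smulRight Complex.I)) x := by
  have h := ((Complex.ofRealCLM.comp (innerSL ℝ α) +
      (Complex.ofRealCLM.comp (innerSL ℝ β)).smulRight Complex.I)).hasFDerivAt (x := x)
  simpa [planeExp] using! h.cexp

theorem fderiv_planeExp_apply (α β x v : R3) :
    fderiv ℝ (planeExp α β) x v =
      ((⟪α, v⟫_ℝ : ℂ) + (⟪β, v⟫_ℝ : ℂ) * Complex.I) * planeExp α β x := by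
  rw [(hasFDerivAt_planeExp α β x).fderiv]
  simp only [smul_apply, add_apply,
    ContinuousLinearMap.comp_apply, ContinuousLinearMap.smulRight_apply, innerSL_apply_apply,
    Complex.ofRealCLM_apply, smul_eq_mul]
  ring

theorem integrable_continuous_mul {f g : R3 → ℂ} (hf : Continuous f) (hg : Continuous g)
    (hgc : HasCompactSupport g) : Integrable fun x => f x * g x :=
  (hf.mul hg).integrable_of_hasCompactSupport hgc.mul_left

theorem continuous_fderiv_apply_const {g : R3 → ℂ} (hg : ContDiff ℝ 1 g) (v : R3) :
    Continuous fun x => fderiv ℝ g x v :=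
  (hg.continuous_fderiv one_ne_zero).clm_apply continuous_const

theorem integral_planeExp_mul_fderiv (α β v : R3) {g : R3 → ℂ} (hg : ContDiff ℝ 1 g)
    (hgc : HasCompactSupport g) :
    ∫ x, planeExp α β x * fderiv ℝ g x v =
      -((⟪α, v⟫_ℝ : ℂ) + (⟪β, v⟫_ℝ : ℂ) * Complex.I) * ∫ x, planeExp α β x * g x := by
  have hc := continuous_planeExp α β
  rw [integral_mul_fderiv_eq_neg_fderiv_mul_of_integrable]
  · rw [neg_mul, ← integral_const_mul]
    simp only [fderiv_planeExp_apply, mul_assoc]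
  · simp only [fderiv_planeExp_apply]
    exact integrable_continuous_mul (by fun_prop) hg.continuous hgc
  · exact integrable_continuous_mul hc (continuous_fderiv_apply_const hg v) (hgc.fderiv_apply ℝ v)
  · exact integrable_continuous_mul hc hg.continuous hgc
  · exact fun x _ => (hasFDerivAt_planeExp α β x).differentiableAt
  · exact fun x _ => hg.differentiable (by norm_num) x

theorem laplacian_eq_sum_fderiv (b : OrthonormalBasis (Fin 3) ℝ R3) {g : R3 → ℂ}
    (hg : ContDiff ℝ 2 g) (x : R3) :
    Δ g x = ∑ i, fderiv ℝ (fun y => fderiv ℝ g y (b i)) x (b i) := by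
  rw [InnerProductSpace.laplacian_eq_iteratedFDeriv_orthonormalBasis g b]
  refine Finset.sum_congr rfl fun i _ => ?_
  rw [iteratedFDeriv_two_apply, fderiv_clm_apply]
  · simp
  · exact (hg.fderiv_right (m := 1) (by norm_num)).differentiable (by norm_num) x
  · fun_prop

theorem continuous_laplacian {g : R3 → ℂ} (hg : ContDiff ℝ 2 g) : Continuous (Δ g) := by
  rw [funext (laplacian_eq_sum_fderiv (EuclideanSpace.basisFun (Fin 3) ℝ) hg)]
  refine continuous_finsetSum _ fun i _ => ?_
  exact continuous_fderiv_apply_const ((hg.fderiv_right (m := 1) (by norm_num)).clm_apply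
    contDiff_const) _

theorem laplacian_eq_zero_of_notMem_tsupport {g : R3 → ℂ} {x : R3} (hx : x ∉ tsupport g) :
    Δ g x = 0 := by
  have h : g =ᶠ[nhds x] fun _ => 0 := notMem_tsupport_iff_eventuallyEq.1 hx
  rw [(InnerProductSpace.laplacian_congr_nhds h).eq_of_nhds]
  simp

theorem hasCompactSupport_laplacian {g : R3 → ℂ} (hgc : HasCompactSupport g) :
    HasCompactSupport (Δ g) :=
  HasCompactSupport.intro hgc fun _ hx => laplacian_eq_zero_of_notMem_tsupport hx

/-- Two integrations by parts in each coordinate move the derivatives onto the exponential; the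
factor is ζ·ζ for ζ = α + iβ. -/
theorem integral_planeExp_mul_laplacian (α β : R3) {g : R3 → ℂ} (hg : ContDiff ℝ 2 g)
    (hgc : HasCompactSupport g) :
    ∫ x, planeExp α β x * Δ g x =
      ((‖α‖ ^ 2 - ‖β‖ ^ 2 : ℝ) + (2 * ⟪α, β⟫_ℝ : ℝ) * Complex.I) * ∫ x, planeExp α β x * g x := by
  set b := EuclideanSpace.basisFun (Fin 3) ℝ
  have hd : ∀ i, ContDiff ℝ 1 fun y => fderiv ℝ g y (b i) := fun i =>
    (hg.fderiv_right (m := 1) (by norm_num)).clm_apply contDiff_const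
  have hdc : ∀ i, HasCompactSupport fun y => fderiv ℝ g y (b i) := fun i => hgc.fderiv_apply ℝ (b i)
  simp_rw [laplacian_eq_sum_fderiv b hg, Finset.mul_sum]
  rw [integral_finsetSum]
  · simp_rw [fun i => integral_planeExp_mul_fderiv α β (b i) (hd i) (hdc i),
      fun i => integral_planeExp_mul_fderiv α β (b i) (hg.of_le (by norm_num)) hgc, ← mul_assoc]
    rw [← Finset.sum_mul]
    congr 1
    rw [← b.sum_sq_norm_inner_right α, ← b.sum_sq_norm_inner_right β, ← b.sum_inner_mul_inner α β]
    push_cast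
    rw [← Finset.sum_sub_distrib, Finset.mul_sum, Finset.sum_mul, ← Finset.sum_add_distrib]
    refine Finset.sum_congr rfl fun i _ => ?_
    have hα : ⟪b i, α⟫_ℝ = ⟪α, b i⟫_ℝ := real_inner_comm _ _
    have hβ : ⟪b i, β⟫_ℝ = ⟪β, b i⟫_ℝ := real_inner_comm _ _
    rw [hα, hβ]
    simp only [← Complex.ofReal_pow, Real.norm_eq_abs, sq_abs]
    push_cast
    linear_combination (⟪β, b i⟫_ℝ : ℂ) ^ 2 * Complex.I_sq
  · intro i _
    exact integrable_continuous_mul (continuous_planeExp α β)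
      (continuous_fderiv_apply_const (hd i) _) ((hdc i).fderiv_apply ℝ (b i))

/-- The symbol `ζ · ζ + k²` at `ζ = α + i β`. -/
noncomputable def helmholtzSymbol (k : ℝ) (α β : R3) : ℂ :=
  ((‖α‖ ^ 2 - ‖β‖ ^ 2 + k ^ 2 : ℝ) : ℂ) + (2 * ⟪α, β⟫_ℝ : ℝ) * Complex.I

theorem integral_planeExp_mul_helmholtz (k : ℝ) (α β : R3) {g : R3 → ℂ} (hg : ContDiff ℝ 2 g)
    (hgc : HasCompactSupport g) :
    ∫ x, planeExp α β x * (-(Δ g x) - (k : ℂ) ^ 2 * g x) =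
      -(helmholtzSymbol k α β * ∫ x, planeExp α β x * g x) := by
  have h1 : Integrable fun x => -(planeExp α β x * Δ g x) :=
    (integrable_continuous_mul (continuous_planeExp α β) (continuous_laplacian hg)
      (hasCompactSupport_laplacian hgc)).neg
  have h2 := (integrable_continuous_mul (continuous_planeExp α β) hg.continuous hgc).const_mul
    ((k : ℂ) ^ 2)
  calc _ = ∫ x, (-(planeExp α β x * Δ g x) - (k : ℂ) ^ 2 * (planeExp α β x * g x)) := by
        congr 1
        funext x
        ring
    _ = _ := by
        rw [integral_sub h1 h2, integral_neg, integral_const_mul,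
          integral_planeExp_mul_laplacian α β hg hgc, helmholtzSymbol]
        push_cast
        ring

end PlaneExp

/-! ### From Fourier series to distributional solutions -/

section Solutions

open scoped ComplexConjugate InnerProductSpace BoundedContinuousFunction

theorem integral_grid_eq {b : OrthonormalBasis (Fin 3) ℝ R3} {ε : ℝ} (c : ℝ≥0∞) {f : R3 → ℂ}
    (hf : ∀ x, x ∉ gridCell b ε → f x = 0) :
    ∫ x, f x ∂(c • volume.restrict (gridCell b ε)) = c.toReal * ∫ x, f x := by
  rw [integral_smul_measure, setIntegral_eq_integral_of_forall_compl_eq_zero hf]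
  simp

/-- Parseval applied to the conjugate of ψ and to H. As ψ is supported in the cell, integrals over
the cell are integrals over space, and c cancels. -/
theorem hasSum_gridCoeff_mul_integral {b : OrthonormalBasis (Fin 3) ℝ R3} {ε : ℝ} {c : ℝ≥0∞}
    (hc0 : c ≠ 0) (hc : c ≠ ∞) [IsFiniteMeasure (c • volume.restrict (gridCell b ε))]
    (hP : ∀ F G : R3 → ℂ, MemLp F 2 (c • volume.restrict (gridCell b ε)) →
        MemLp G 2 (c • volume.restrict (gridCell b ε)) →
        HasSum (fun n => conj (gridCoeff b ε (c • volume.restrict (gridCell b ε)) F n) *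
          gridCoeff b ε (c • volume.restrict (gridCell b ε)) G n)
          (∫ x, conj (F x) * G x ∂(c • volume.restrict (gridCell b ε))))
    {ψ H : R3 → ℂ} (hψ : Continuous ψ) (hψc : HasCompactSupport ψ)
    (hψs : ∀ x, x ∉ gridCell b ε → ψ x = 0)
    (hH : MemLp H 2 (c • volume.restrict (gridCell b ε))) :
    HasSum (fun n => gridCoeff b ε (c • volume.restrict (gridCell b ε)) H n *
      ∫ x, gridMode b ε n x * ψ x) (∫ x, H x * ψ x) := by
  set ν := c • volume.restrict (gridCell b ε) with hν
  have hψ2 : MemLp (fun x => conj (ψ x)) 2 ν :=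
    (Complex.continuous_conj.comp hψ).memLp_of_hasCompactSupport
      (hψc.comp_left (map_zero _))
  have h := hP _ _ hψ2 hH
  have hct : (c.toReal : ℂ) ≠ 0 := by
    exact_mod_cast (ENNReal.toReal_pos hc0 hc).ne'
  have h' := h.mul_left ((c.toReal : ℂ)⁻¹)
  have hcoe : ∀ n, gridCoeff b ε ν H n * ∫ x, gridMode b ε n x * ψ x =
      (c.toReal : ℂ)⁻¹ * (conj (gridCoeff b ε ν (fun x => conj (ψ x)) n) *
        gridCoeff b ε ν H n) := by
    intro n
    have : conj (gridCoeff b ε ν (fun x => conj (ψ x)) n) =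
        c.toReal * ∫ x, gridMode b ε n x * ψ x := by
      rw [gridCoeff, ← integral_conj, ← integral_grid_eq (b := b) (ε := ε) c]
      · simp [hν]
      · intro x hx
        rw [hψs x hx, mul_zero]
    rw [this]
    field_simp
  have hval : ∫ x, H x * ψ x = (c.toReal : ℂ)⁻¹ * ∫ x, conj (conj (ψ x)) * H x ∂ν := by
    simp only [Complex.conj_conj]
    rw [integral_grid_eq c, inv_mul_cancel_left₀ hct]
    · simp only [mul_comm]
    · intro x hx
      rw [hψs x hx, zero_mul]
  simpa only [hcoe, hval] using! h'

/-- The frequency vector of `gridMode`. -/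
noncomputable def gridVector (b : OrthonormalBasis (Fin 3) ℝ R3) (ε : ℝ) (n : Fin 3 → ℤ) : R3 :=
  ∑ i, (ε * n i) • b i

theorem planeExp_mul_gridMode (b : OrthonormalBasis (Fin 3) ℝ R3) (ε : ℝ) (n : Fin 3 → ℤ)
    (α β x : R3) : planeExp α β x * gridMode b ε n x = planeExp α (β + gridVector b ε n) x := by
  unfold planeExp gridMode gridVector
  rw [← Complex.exp_add, inner_add_left, sum_inner, Finset.mul_sum]
  simp only [inner_smul_left, RCLike.conj_to_real, mul_assoc]
  congr 1
  push_cast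
  ring

/-- Tested against φ, the operator multiplies each mode by minus its symbol, so by `hu` and Parseval
the series contributes the negative of the potential term. The E part contributes nothing because
its symbol vanishes (`h0`). -/
theorem mem_schrodingerSolutions_of_gridSeries {b : OrthonormalBasis (Fin 3) ℝ R3} {ε : ℝ}
    {c : ℝ≥0∞} (hc0 : c ≠ 0) (hc : c ≠ ∞) [IsFiniteMeasure (c • volume.restrict (gridCell b ε))]
    (hP : ∀ F G : R3 → ℂ, MemLp F 2 (c • volume.restrict (gridCell b ε)) →
        MemLp G 2 (c • volume.restrict (gridCell b ε)) →
        HasSum (fun n => conj (gridCoeff b ε (c • volume.restrict (gridCell b ε)) F n) *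
          gridCoeff b ε (c • volume.restrict (gridCell b ε)) G n)
          (∫ x, conj (F x) * G x ∂(c • volume.restrict (gridCell b ε))))
    {D : Opens R3} (hD : (D : Set R3) ⊆ gridCell b ε) {q : R3 → ℝ} (hq : MemLp q 2 volume)
    {k : ℝ} {α β β₀ : R3} (h0 : helmholtzSymbol k α β₀ = 0) (E : R3 →ᵇ ℂ)
    (hE : ∀ x, planeExp α β x * E x = planeExp α β₀ x) {u : (Fin 3 → ℤ) → ℂ}
    (hus : Summable fun n => ‖u n‖)
    (hu : ∀ n, u n * helmholtzSymbol k α (β + gridVector b ε n) =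
      gridCoeff b ε (c • volume.restrict (gridCell b ε))
        (fun x => (q x : ℂ) * (E x + ∑' m, u m * gridMode b ε m x)) n) :
    (fun x => planeExp α β x * (E x + ∑' m, u m * gridMode b ε m x)) ∈
      schrodingerSolutions q k D := by
  set ν := c • volume.restrict (gridCell b ε) with hν
  set P : R3 →ᵇ ℂ := ∑' n, u n • gridModeBCF b ε n with hPdef
  have hPx : ∀ x, ∑' m, u m * gridMode b ε m x = P x := fun x =>
    (tsum_smul_gridModeBCF_apply b ε hus x).symm
  simp only [hPx] at hu ⊢
  have hexp := continuous_planeExp α β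
  have hwc : Continuous fun x => planeExp α β x * (E x + P x) :=
    hexp.mul (E.continuous.add P.continuous)
  have hqC : LocallyIntegrable (fun x => (q x : ℂ)) volume :=
    (MemLp.ofReal (K := ℂ) hq).locallyIntegrable (by norm_num)
  have hqw : LocallyIntegrable (fun x => (q x : ℂ) * (planeExp α β x * (E x + P x))) volume := by
    rw [← locallyIntegrableOn_univ] at hqC ⊢
    exact hqC.mul_continuousOn hwc.continuousOn isOpen_univ.isLocallyClosed
  refine ⟨hwc.locallyIntegrable.locallyIntegrableOn _, hqw.locallyIntegrableOn _, fun φ => ?_⟩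
  have hφ : ContDiff ℝ 2 (φ : R3 → ℂ) := φ.contDiff.of_le (WithTop.coe_le_coe.2 (le_top : (2 : ℕ∞) ≤ ⊤))
  have hφc : HasCompactSupport (φ : R3 → ℂ) := φ.hasCompactSupport
  have hφD : tsupport (φ : R3 → ℂ) ⊆ D := φ.tsupport_subset
  have hφ0 : ∀ x, x ∉ (D : Set R3) → φ x = 0 := fun x hx =>
    image_eq_zero_of_notMem_tsupport fun h => hx (hφD h)
  have hΔ0 : ∀ x, x ∉ (D : Set R3) → Δ (φ : R3 → ℂ) x = 0 := fun x hx =>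
    laplacian_eq_zero_of_notMem_tsupport fun h => hx (hφD h)
  rw [setIntegral_eq_integral_of_forall_compl_eq_zero fun x hx => by
    rw [hφ0 x hx, hΔ0 x hx]; simp]
  set χ : R3 → ℂ := fun x => -(Δ (φ : R3 → ℂ) x) - (k : ℂ) ^ 2 * φ x with hχ
  have hχc : Continuous χ := by
    have := continuous_laplacian hφ
    have := hφ.continuous
    fun_prop
  have hχs : HasCompactSupport χ :=
    (hasCompactSupport_laplacian hφc).neg.sub hφc.mul_left
  set ψ : R3 → ℂ := fun x => planeExp α β x * φ x with hψ
  have hψc : Continuous ψ := hexp.mul hφ.continuous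
  have hψs : HasCompactSupport ψ := hφc.mul_left
  set H : R3 → ℂ := fun x => (q x : ℂ) * (E x + P x) with hH
  have hH2 : MemLp H 2 ν :=
    memLp_ofReal_mul_boundedContinuous (hq.restrict _ |>.smul_measure hc) (E + P)
  have hHψ : Integrable fun x => H x * ψ x := by
    have := hqw.integrable_smul_right_of_hasCompactSupport hφ.continuous hφc
    refine this.congr (Filter.Eventually.of_forall fun x => ?_)
    simp only [hH, hψ, smul_eq_mul]
    ring
  have hsum1 : HasSum (fun n => gridCoeff b ε ν H n * ∫ x, gridMode b ε n x * ψ x)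
      (∫ x, H x * ψ x) :=
    hasSum_gridCoeff_mul_integral hc0 hc hP hψc hψs
      (fun x hx => by simp only [hψ, hφ0 x fun h => hx (hD h), mul_zero]) hH2
  have hint : Integrable fun x => planeExp α β x * χ x := integrable_continuous_mul hexp hχc hχs
  -- Termwise integration is legitimate because the modes have modulus one and u is absolutely
  -- summable.
  have hsum2 : HasSum (fun n => ∫ x, u n * (gridMode b ε n x * (planeExp α β x * χ x)))
      (∫ x, ∑' n, u n * (gridMode b ε n x * (planeExp α β x * χ x))) := by
    refine hasSum_integral_of_summable_integral_norm (fun n => ?_) ?_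
    · exact (hint.bdd_mul (c := 1) (continuous_gridMode b ε n).aestronglyMeasurable
        (Filter.Eventually.of_forall fun x => (norm_gridMode b ε n x).le)).const_mul _
    · simp only [norm_mul (u _), norm_mul (gridMode b ε _ _), norm_gridMode, one_mul,
        integral_const_mul]
      exact hus.mul_right _
  have hterm : ∀ n, ∫ x, u n * (gridMode b ε n x * (planeExp α β x * χ x)) =
      -(gridCoeff b ε ν H n * ∫ x, gridMode b ε n x * ψ x) := by
    intro n
    have e1 : ∀ x, gridMode b ε n x * (planeExp α β x * χ x) =
        planeExp α (β + gridVector b ε n) x * χ x := fun x => by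
      rw [← planeExp_mul_gridMode]; ring
    have e2 : ∀ x, gridMode b ε n x * ψ x =
        planeExp α (β + gridVector b ε n) x * φ x := fun x => by
      rw [← planeExp_mul_gridMode, hψ]; ring
    simp only [e1, e2, integral_const_mul]
    rw [integral_planeExp_mul_helmholtz k _ _ hφ hφc, ← hu]
    ring
  simp only [hterm] at hsum2
  have hser : ∫ x, P x * (planeExp α β x * χ x) = -∫ x, H x * ψ x := by
    rw [← hsum2.unique hsum1.neg]
    simp only [← mul_assoc, tsum_mul_right, hPx]
  have hfree : ∫ x, E x * (planeExp α β x * χ x) = 0 := by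
    have e1 : ∀ x, E x * (planeExp α β x * χ x) = planeExp α β₀ x * χ x := fun x => by
      rw [← hE]; ring
    simp only [e1]
    rw [integral_planeExp_mul_helmholtz k _ _ hφ hφc, h0]
    simp
  have hintE : ∀ F : R3 →ᵇ ℂ, Integrable fun x => F x * (planeExp α β x * χ x) := fun F =>
    integrable_continuous_mul F.continuous (hexp.mul hχc) hχs.mul_left
  calc _ = ∫ x, (E x * (planeExp α β x * χ x) + P x * (planeExp α β x * χ x) + H x * ψ x) := by
        congr 1
        funext x
        simp only [hχ, hH, hψ]
        ring
    _ = 0 := by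
        rw [integral_add (f := fun x => E x * (planeExp α β x * χ x) + P x * (planeExp α β x * χ x))
          ((hintE E).add (hintE P)) hHψ, integral_add (hintE E) (hintE P), hser,
          hfree]
        ring

end Solutions

/-! ### Complex geometrical optics solutions -/

section CGO

open scoped ComplexConjugate InnerProductSpace BoundedContinuousFunction

theorem hasSum_sq_norm_gridCoeff {b : OrthonormalBasis (Fin 3) ℝ R3} {ε : ℝ} {ν : Measure R3}
    {F : R3 → ℂ} (h : HasSum (fun n => conj (gridCoeff b ε ν F n) * gridCoeff b ε ν F n)
      (∫ x, conj (F x) * F x ∂ν)) :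
    HasSum (fun n => ‖gridCoeff b ε ν F n‖ ^ 2) (∫ x, ‖F x‖ ^ 2 ∂ν) := by
  simp only [Complex.conj_mul'] at h
  have e : ∫ x, (‖F x‖ : ℂ) ^ 2 ∂ν = ((∫ x, ‖F x‖ ^ 2 ∂ν : ℝ) : ℂ) := by
    rw [← integral_complex_ofReal]
    simp
  rw [e] at h
  exact_mod_cast h

theorem norm_sq_smul_add (b : OrthonormalBasis (Fin 3) ℝ R3) (x y z : ℝ) :
    ‖x • b 0 + y • b 1 + z • b 2‖ ^ 2 = x ^ 2 + y ^ 2 + z ^ 2 := by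
  rw [← b.sum_sq_norm_inner_right]
  simp [Fin.sum_univ_three, inner_add_right, inner_smul_right, b.inner_eq_ite]

theorem inner_smul_add (b : OrthonormalBasis (Fin 3) ℝ R3) (t x y z : ℝ) :
    ⟪t • b 0, x • b 0 + y • b 1 + z • b 2⟫_ℝ = t * x := by
  simp [inner_add_right, inner_smul_right, inner_smul_left, b.inner_eq_ite, mul_comm]

theorem norm_sq_helmholtzSymbol (b : OrthonormalBasis (Fin 3) ℝ R3) {ε t s r k : ℝ}
    (h : s ^ 2 + r ^ 2 = t ^ 2 + k ^ 2) (n : Fin 3 → ℤ) :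
    ‖helmholtzSymbol k (t • b 0)
      (s • b 1 + r • b 2 + (ε / 2) • b 0 + gridVector b ε n)‖ ^ 2 = latticeSymbolSq ε t s r n := by
  have e : s • b 1 + r • b 2 + (ε / 2) • b 0 + gridVector b ε n =
      (ε * n 0 + ε / 2) • b 0 + (ε * n 1 + s) • b 1 + (ε * n 2 + r) • b 2 := by
    rw [gridVector, Fin.sum_univ_three]
    module
  rw [helmholtzSymbol, e, norm_sq_smul_add, inner_smul_add, norm_smul, b.orthonormal.1,
    ← Complex.normSq_eq_norm_sq, Complex.normSq_add_mul_I, latticeSymbolSq, h]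
  simp only [Real.norm_eq_abs, mul_one, sq_abs]
  ring

theorem norm_planeExp_zero (β x : R3) : ‖planeExp 0 β x‖ = 1 := by
  simp [norm_planeExp]

/-- Complex geometrical optics solutions `exp (θ · x) (1 + R)` with `θ = t b₀ + i (s b₁ + r b₂)` and
remainder uniformly small for large `|t|`. -/
theorem exists_geometricOptics_solution (b : OrthonormalBasis (Fin 3) ℝ R3) {ε : ℝ} (hε : 0 < ε)
    {D : Opens R3} (hD : (D : Set R3) ⊆ gridCell b ε) {q : R3 → ℝ} (hq : MemLp q 2 volume)
    (k r : ℝ) {δ : ℝ} (hδ : 0 < δ) :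
    ∃ T : ℝ, 0 < T ∧ ∀ t s : ℝ, T ≤ |t| → s ^ 2 + r ^ 2 = t ^ 2 + k ^ 2 →
      ∃ R : R3 → ℂ, Continuous R ∧ (∀ x, ‖R x‖ ≤ δ) ∧
        (fun x => planeExp (t • b 0) (s • b 1 + r • b 2) x * (1 + R x)) ∈
          schrodingerSolutions q k D := by
  obtain ⟨c, hc0, hc, hfin, hP⟩ := exists_hasSum_gridCoeff b hε
  set ν := c • volume.restrict (gridCell b ε) with hν
  have hqν : MemLp q 2 ν := (hq.restrict _).smul_measure hc
  set K := √(∫ x, q x ^ 2 ∂ν)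
  have hK : 0 ≤ K := Real.sqrt_nonneg _
  -- Then ηK ≤ 1/2 makes the map a contraction and 2ηK ≤ δ bounds the remainder; the +1 covers K =
  -- 0.
  set η := min 1 δ / (2 * (K + 1)) with hη
  have hη0 : 0 < η := by positivity
  have hηK : η * K ≤ min 1 δ / 2 := by
    rw [hη, div_mul_eq_mul_div, div_le_div_iff₀ (by positivity) (by norm_num)]
    have : 0 < min 1 δ := by positivity
    nlinarith
  obtain ⟨T, hT0, hT⟩ := exists_tsum_inv_latticeSymbolSq_le hε r k (δ := η ^ 2) (by positivity)
  refine ⟨T, hT0, fun t s ht hs => ?_⟩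
  have ht0 : t ≠ 0 := abs_pos.1 (hT0.trans_le ht)
  set β := s • b 1 + r • b 2 + (ε / 2) • b 0 with hβ
  set σ : (Fin 3 → ℤ) → ℂ := fun n => helmholtzSymbol k (t • b 0) (β + gridVector b ε n) with hσ
  have hσsq : ∀ n, ‖σ n‖ ^ 2 = latticeSymbolSq ε t s r n := norm_sq_helmholtzSymbol b hs
  have hσ0 : ∀ n, σ n ≠ 0 := fun n h => by
    have := latticeSymbolSq_pos hε ht0 s r n
    rw [← hσsq, h] at this
    simp at this
  have hsum := hT t s ht hs
  simp only [← hσsq] at hsum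
  have hσs : Summable fun n => (‖σ n‖ ^ 2)⁻¹ := by
    have := ENNReal.summable_toReal (hsum.trans_lt ENNReal.ofReal_lt_top).ne
    refine this.congr fun n => ENNReal.toReal_ofReal (by positivity)
  have hσδ : ∑' n, (‖σ n‖ ^ 2)⁻¹ ≤ η ^ 2 := by
    rwa [← ENNReal.ofReal_tsum_of_nonneg (fun n => by positivity) hσs,
      ENNReal.ofReal_le_ofReal_iff (by positivity)] at hsum
  -- E undoes the half shift contained in β, so the leading term is the unshifted free exponential.
  -- It need only be bounded, not periodic.
  let E : R3 →ᵇ ℂ := BoundedContinuousFunction.ofNormedAddCommGroup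
    (planeExp 0 (-((ε / 2) • b 0))) (continuous_planeExp _ _) 1 fun x => (norm_planeExp_zero _ x).le
  have hE1 : ‖E‖ ≤ 1 := BoundedContinuousFunction.norm_ofNormedAddCommGroup_le _ zero_le_one _
  obtain ⟨u, hus, hub, hu⟩ := exists_gridSeries_solution
    (fun F hF => hasSum_sq_norm_gridCoeff (hP F F hF hF)) hqν E hE1 hη0.le hσs hσδ
    (hηK.trans (by linarith [min_le_left 1 δ]))
  have hEβ : ∀ x, planeExp (t • b 0) β x * E x = planeExp (t • b 0) (s • b 1 + r • b 2) x := by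
    intro x
    change _ * planeExp 0 _ x = _
    rw [← planeExp_add, add_zero, hβ, add_neg_cancel_right]
  have hmem := mem_schrodingerSolutions_of_gridSeries hc0 hc hP hD hq (k := k) (α := t • b 0) ?_ E
    hEβ hus (fun n => by rw [hu n]; exact div_mul_cancel₀ _ (hσ0 n))
  swap
  · have := norm_sq_smul_add b 0 s r
    rw [zero_smul, zero_add] at this
    have h2 := inner_smul_add b t 0 s r
    rw [zero_smul, zero_add, mul_zero] at h2
    rw [helmholtzSymbol, this, h2, norm_smul, b.orthonormal.1]
    have : (‖t‖ * 1) ^ 2 - (0 ^ 2 + s ^ 2 + r ^ 2) + k ^ 2 = 0 := by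
      rw [mul_one, Real.norm_eq_abs, sq_abs]
      linarith
    rw [this]
    simp
  have hPx : ∀ x, ∑' n, u n * gridMode b ε n x = (∑' n, u n • gridModeBCF b ε n) x := fun x =>
    (tsum_smul_gridModeBCF_apply b ε hus x).symm
  refine ⟨fun x => planeExp 0 ((ε / 2) • b 0) x * ∑' n, u n * gridMode b ε n x, ?_, fun x => ?_, ?_⟩
  · simp only [hPx]
    exact (continuous_planeExp _ _).mul (BoundedContinuousFunction.continuous _)
  · rw [norm_mul, norm_planeExp_zero, one_mul, hPx]
    refine (BoundedContinuousFunction.norm_coe_le_norm _ x).trans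
      ((norm_tsum_smul_gridModeBCF_le b ε hus).trans (hub.trans ?_))
    linarith [min_le_right 1 δ]
  · convert hmem using 2 with x
    rw [mul_add, mul_add, hEβ, mul_one, ← mul_assoc, ← planeExp_add, add_zero]

end CGO

/-! ### Fourier uniqueness and products of solutions -/

section Completeness

open scoped ComplexConjugate InnerProductSpace

/-- The finite measures with densities g⁺ and g⁻ have the same characteristic function, hence
coincide, and g⁺ = g⁻ forces g = 0. -/
theorem ae_eq_zero_of_forall_integral_real_mul_planeExp {μ : Measure R3} {g : R3 → ℝ}
    (hg : Integrable g μ) (h : ∀ ξ, ∫ x, (g x : ℂ) * planeExp 0 ξ x ∂μ = 0) : g =ᵐ[μ] 0 := by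
  have hm : AEMeasurable (fun x => ENNReal.ofReal (g x)) μ := hg.aemeasurable.ennreal_ofReal
  have hm' : AEMeasurable (fun x => ENNReal.ofReal (-g x)) μ := hg.neg.aemeasurable.ennreal_ofReal
  have : IsFiniteMeasure (μ.withDensity fun x => ENNReal.ofReal (g x)) :=
    isFiniteMeasure_withDensity_ofReal hg.2
  have : IsFiniteMeasure (μ.withDensity fun x => ENNReal.ofReal (-g x)) :=
    isFiniteMeasure_withDensity_ofReal hg.neg.2
  have hint : ∀ {f : R3 → ℝ}, Integrable f μ → ∀ ξ,
      Integrable (fun x => (ENNReal.ofReal (f x)).toReal • planeExp 0 ξ x) μ := by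
    intro f hf ξ
    simp only [ENNReal.toReal_ofReal', Complex.real_smul]
    exact hf.pos_part.ofReal.mul_bdd (c := 1)
      (continuous_planeExp 0 ξ).aestronglyMeasurable
      (Filter.Eventually.of_forall fun x => (norm_planeExp_zero ξ x).le)
  have heq : (μ.withDensity fun x => ENNReal.ofReal (g x)) =
      μ.withDensity fun x => ENNReal.ofReal (-g x) := by
    refine Measure.ext_of_charFun (funext fun ξ => ?_)
    have e : ∀ x : R3, Complex.exp (⟪x, ξ⟫_ℝ * Complex.I) = planeExp 0 ξ x := fun x => by
      simp [planeExp, real_inner_comm]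
    simp only [charFun_apply, e]
    rw [integral_withDensity_eq_integral_toReal_smul₀ hm
      (Filter.Eventually.of_forall fun _ => ENNReal.ofReal_lt_top),
      integral_withDensity_eq_integral_toReal_smul₀ hm'
      (Filter.Eventually.of_forall fun _ => ENNReal.ofReal_lt_top), ← sub_eq_zero,
      ← integral_sub (hint hg ξ) (hint (f := fun x => -g x) hg.neg ξ), ← h ξ]
    congr 1
    funext x
    rw [← sub_smul, ENNReal.toReal_ofReal', ENNReal.toReal_ofReal', Complex.real_smul]
    congr 2
    rcases le_total 0 (g x) with h0 | h0
    · rw [max_eq_left h0, max_eq_right (by linarith)]; ring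
    · rw [max_eq_right h0, max_eq_left (by linarith)]; ring
  rw [withDensity_eq_iff hm hm' (by
    have := isFiniteMeasure_withDensity_ofReal hg.2
    simpa using (measure_lt_top (μ.withDensity fun x => ENNReal.ofReal (g x)) Set.univ).ne)] at heq
  filter_upwards [heq] with x hx
  rcases le_total 0 (g x) with h0 | h0
  · rw [ENNReal.ofReal_of_nonpos (by linarith : -g x ≤ 0), ENNReal.ofReal_eq_zero] at hx
    exact le_antisymm hx h0
  · rw [ENNReal.ofReal_of_nonpos h0, eq_comm, ENNReal.ofReal_eq_zero] at hx
    exact le_antisymm h0 (neg_nonpos.1 hx)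

/-- An integrable function with vanishing Fourier transform is zero. -/
theorem ae_eq_zero_of_forall_integral_mul_planeExp {μ : Measure R3} {f : R3 → ℂ}
    (hf : Integrable f μ) (h : ∀ ξ, ∫ x, f x * planeExp 0 ξ x ∂μ = 0) : f =ᵐ[μ] 0 := by
  have hint : ∀ {g : R3 → ℂ}, Integrable g μ → ∀ ξ, Integrable (fun x => g x * planeExp 0 ξ x) μ :=
    fun hg ξ => hg.mul_bdd (c := 1) (continuous_planeExp 0 ξ).aestronglyMeasurable
      (Filter.Eventually.of_forall fun x => (norm_planeExp_zero ξ x).le)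
  have hconj : Integrable (fun x => conj (f x)) μ := (Complex.conjCLE.integrable_comp_iff).2 hf
  have h' : ∀ ξ, ∫ x, conj (f x) * planeExp 0 ξ x ∂μ = 0 := by
    intro ξ
    have e : ∀ x, conj (f x) * planeExp 0 ξ x = conj (f x * planeExp 0 (-ξ) x) := fun x => by
      rw [map_mul]
      congr 1
      simp [planeExp, ← Complex.exp_conj]
    simp only [e]
    rw [integral_conj, h, map_zero]
  have hre := ae_eq_zero_of_forall_integral_real_mul_planeExp hf.re fun ξ => by
    have e : ∀ x, ((RCLike.re (f x) : ℝ) : ℂ) * planeExp 0 ξ x =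
        2⁻¹ * (f x * planeExp 0 ξ x + conj (f x) * planeExp 0 ξ x) := fun x => by
      have := Complex.re_eq_add_conj (f x)
      change ((f x).re : ℂ) * _ = _
      rw [this]
      ring
    simp only [e]
    rw [integral_const_mul, integral_add (hint hf ξ) (hint hconj ξ), h, h', add_zero, mul_zero]
  have him := ae_eq_zero_of_forall_integral_real_mul_planeExp hf.im fun ξ => by
    have e : ∀ x, ((RCLike.im (f x) : ℝ) : ℂ) * planeExp 0 ξ x =
        (2 * Complex.I)⁻¹ * (f x * planeExp 0 ξ x - conj (f x) * planeExp 0 ξ x) := fun x => by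
      have := Complex.im_eq_sub_conj (f x)
      change ((f x).im : ℂ) * _ = _
      rw [this]
      ring
    simp only [e]
    rw [integral_const_mul, integral_sub (hint hf ξ) (hint hconj ξ), h, h', sub_zero, mul_zero]
  filter_upwards [hre, him] with x h1 h2
  exact Complex.ext h1 h2

theorem exists_orthonormalBasis_smul_eq (ξ : R3) :
    ∃ b : OrthonormalBasis (Fin 3) ℝ R3, ‖ξ‖ • b 2 = ξ := by
  by_cases hξ : ξ = 0
  · exact ⟨EuclideanSpace.basisFun (Fin 3) ℝ, by simp [hξ]⟩
  · have hn : ‖ξ‖ ≠ 0 := norm_ne_zero_iff.2 hξ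
    have ho : Orthonormal ℝ (({2} : Set (Fin 3)).domRestrict fun _ => ‖ξ‖⁻¹ • ξ) := by
      refine ⟨fun i => ?_, fun i j hij => (hij (Subsingleton.elim i j)).elim⟩
      simp [norm_smul, hn]
    obtain ⟨b, hb⟩ := ho.exists_orthonormalBasis_extension_of_card_eq (by simp)
    exact ⟨b, by rw [hb 2 rfl, smul_smul, mul_inv_cancel₀ hn, one_smul]⟩

/-- The values of q on the sphere |x| = a are unconstrained, but the sphere is a null set. -/
theorem memLp_two_of_mem_Qa {a : ℝ} {q : R3 → ℝ} (hq : q ∈ Qa a) : MemLp q 2 volume := by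
  have h1 : MemLp q 2 (volume.restrict (Metric.closedBall (0 : R3) a)) := by
    have hs : Metric.ball (0 : R3) a =ᵐ[volume] Metric.closedBall 0 a := by
      rw [← Metric.ball_union_sphere]
      exact (union_ae_eq_left_of_ae_eq_empty
        (ae_eq_empty.2 (Measure.addHaar_sphere volume (0 : R3) a))).symm
    rw [← Measure.restrict_congr_set hs]
    exact hq.1
  rw [← memLp_indicator_iff_restrict Metric.isClosed_closedBall.measurableSet] at h1
  convert h1
  rw [eq_comm, Set.indicator_eq_self]
  intro x hx
  by_contra hxa
  exact hx (hq.2 x (by simpa using hxa))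

theorem exists_subset_gridCell {D : Set R3} (hD : Bornology.IsBounded D) :
    ∃ ε : ℝ, 0 < ε ∧ ∀ b : OrthonormalBasis (Fin 3) ℝ R3, D ⊆ gridCell b ε := by
  obtain ⟨M, hM, hDM⟩ := hD.subset_ball_lt 0 0
  refine ⟨Real.pi / M, by positivity, fun b x hx i => ?_⟩
  have hxM : ‖x‖ < M := by simpa using hDM hx
  have h1 : |⟪b i, x⟫_ℝ| ≤ ‖x‖ := by
    simpa using abs_real_inner_le_norm (b i) x
  have h2 : |Real.pi / M * ⟪b i, x⟫_ℝ| < Real.pi := by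
    rw [abs_mul, abs_of_pos (by positivity : 0 < Real.pi / M)]
    calc Real.pi / M * |⟪b i, x⟫_ℝ| < Real.pi / M * M := by
          gcongr
          exact h1.trans_lt hxM
      _ = Real.pi := by field_simp
  exact ⟨(abs_lt.1 h2).1, (abs_lt.1 h2).2.le⟩

/-- Orthogonality to bounded products of solutions forces the Fourier transform to vanish. -/
theorem integral_mul_planeExp_eq_zero {q₁ q₂ : R3 → ℝ} (hq₁ : MemLp q₁ 2 volume)
    (hq₂ : MemLp q₂ 2 volume) (k : ℝ) {D : Opens R3} (hD : Bornology.IsBounded (D : Set R3))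
    {f : R3 → ℂ} (hf : IntegrableOn f D)
    (h : ∀ w₁ ∈ schrodingerSolutions q₁ k D, ∀ w₂ ∈ schrodingerSolutions q₂ k D,
      MemLp (fun x => w₁ x * w₂ x) ∞ (volume.restrict (D : Set R3)) →
      ∫ x in (D : Set R3), f x * (w₁ x * w₂ x) = 0) (ξ : R3) :
    ∫ x in (D : Set R3), f x * planeExp 0 ξ x = 0 := by
  obtain ⟨ε, hε, hcell⟩ := exists_subset_gridCell hD
  obtain ⟨b, hb⟩ := exists_orthonormalBasis_smul_eq ξ
  set r := ‖ξ‖ / 2 with hr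
  set I := ∫ x in (D : Set R3), ‖f x‖
  have hI : 0 ≤ I := integral_nonneg fun x => norm_nonneg _
  have key : ∀ δ : ℝ, 0 < δ → δ ≤ 1 →
      ‖∫ x in (D : Set R3), f x * planeExp 0 ξ x‖ ≤ δ * (3 * I) := by
    intro δ hδ hδ1
    obtain ⟨T₁, hT₁, H₁⟩ := exists_geometricOptics_solution b hε (hcell b) hq₁ k r hδ
    obtain ⟨T₂, hT₂, H₂⟩ := exists_geometricOptics_solution b hε (hcell b) hq₂ k r hδ
    have hr0 : 0 ≤ r := by positivity
    -- Large enough for both solutions; t ≥ r also makes the radicand defining s nonnegative.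
    set t := T₁ + T₂ + r with ht
    have hts : √(t ^ 2 + k ^ 2 - r ^ 2) ^ 2 + r ^ 2 = t ^ 2 + k ^ 2 := by
      rw [Real.sq_sqrt (by nlinarith [sq_nonneg k]), sub_add_cancel]
    set s := √(t ^ 2 + k ^ 2 - r ^ 2)
    obtain ⟨R₁, hR₁c, hR₁, hw₁⟩ := H₁ t s (le_abs.2 (Or.inl (by linarith))) hts
    -- Reversing t and s but keeping r leaves only the frequency 2r b₂ = ξ in the product.
    obtain ⟨R₂, hR₂c, hR₂, hw₂⟩ := H₂ (-t) (-s) (le_abs.2 (Or.inr (by linarith)))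
      (by rw [neg_sq, neg_sq, hts])
    have hprod : ∀ x, planeExp (t • b 0) (s • b 1 + r • b 2) x * (1 + R₁ x) *
        (planeExp (-t • b 0) (-s • b 1 + r • b 2) x * (1 + R₂ x)) =
        planeExp 0 ξ x * ((1 + R₁ x) * (1 + R₂ x)) := by
      intro x
      have e1 : t • b 0 + -t • b 0 = 0 := by module
      have e2 : s • b 1 + r • b 2 + (-s • b 1 + r • b 2) = ξ := by
        rw [← hb, hr, show ‖ξ‖ = ‖‖ξ‖ • b 2‖ by rw [hb], hb]
        module
      rw [mul_mul_mul_comm, ← planeExp_add, e1, e2]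
    have hc : Continuous fun x => planeExp 0 ξ x * ((1 + R₁ x) * (1 + R₂ x)) := by
      have := continuous_planeExp 0 ξ
      fun_prop
    have hortho := h _ hw₁ _ hw₂
    simp only [hprod] at hortho
    have h0 := hortho (memLp_top_of_bound hc.aestronglyMeasurable ((1 + δ) * (1 + δ))
      (Filter.Eventually.of_forall fun x => by
        rw [norm_mul, norm_mul, norm_planeExp_zero, one_mul]
        gcongr
        · exact (norm_add_le _ _).trans (by rw [norm_one]; linarith [hR₁ x])
        · exact (norm_add_le _ _).trans (by rw [norm_one]; linarith [hR₂ x])))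
    have hfe : IntegrableOn (fun x => f x * planeExp 0 ξ x) D :=
      hf.mul_bdd (c := 1) (continuous_planeExp 0 ξ).aestronglyMeasurable
        (Filter.Eventually.of_forall fun x => (norm_planeExp_zero ξ x).le)
    have hρ : ∀ x, ‖R₁ x + R₂ x + R₁ x * R₂ x‖ ≤ 3 * δ := by
      intro x
      have h3 : ‖R₁ x * R₂ x‖ ≤ δ * 1 := by
        rw [norm_mul]
        exact mul_le_mul (hR₁ x) ((hR₂ x).trans hδ1) (norm_nonneg _) hδ.le
      linarith [norm_add_le (R₁ x + R₂ x) (R₁ x * R₂ x), norm_add_le (R₁ x) (R₂ x), hR₁ x, hR₂ x]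
    have hfρ : IntegrableOn (fun x => f x * planeExp 0 ξ x * (R₁ x + R₂ x + R₁ x * R₂ x)) D :=
      hfe.mul_bdd (c := 3 * δ) (by fun_prop : Continuous _).aestronglyMeasurable
        (Filter.Eventually.of_forall hρ)
    -- Expand (1 + R₁)(1 + R₂) in the orthogonality relation and isolate the term 1.
    have hsplit : ∫ x in (D : Set R3), f x * planeExp 0 ξ x =
        -∫ x in (D : Set R3), f x * planeExp 0 ξ x * (R₁ x + R₂ x + R₁ x * R₂ x) := by
      rw [eq_neg_iff_add_eq_zero, ← integral_add hfe hfρ, ← h0]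
      congr 1
      funext x
      ring
    rw [hsplit, norm_neg]
    refine (norm_integral_le_of_norm_le (hf.norm.mul_const (3 * δ))
      (Filter.Eventually.of_forall fun x => ?_)).trans (le_of_eq ?_)
    · rw [norm_mul, norm_mul, norm_planeExp_zero, mul_one]
      gcongr
      exact hρ x
    · rw [integral_mul_const]
      ring
  rw [← norm_le_zero_iff]
  refine le_of_forall_pos_le_add fun η hη => ?_
  have hδ : 0 < min 1 (η / (3 * I + 1)) := by positivity
  refine (key _ hδ (min_le_left _ _)).trans ?_
  calc min 1 (η / (3 * I + 1)) * (3 * I) ≤ η / (3 * I + 1) * (3 * I + 1) := by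
        gcongr
        · exact min_le_right _ _
        · linarith
    _ = 0 + η := by field_simp; ring

end Completeness

theorem theorem1p1 (a : ℝ) (ha : 0 < a) (q₁ q₂ : R3 → ℝ) (hq₁ : q₁ ∈ Qa a) (hq₂ : q₂ ∈ Qa a)
    (k : ℝ) (hk : 0 ≤ k) (D : Opens R3) (hD : Bornology.IsBounded (D : Set R3)) :
    HasPropertyC (schrodingerSolutions q₁ k D) (schrodingerSolutions q₂ k D) D := by
  intro p hp f hf h
  have : IsFiniteMeasure (volume.restrict (D : Set R3)) := ⟨by
    rw [Measure.restrict_apply_univ]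
    exact hD.measure_lt_top⟩
  have hf1 : IntegrableOn f D := hf.integrable hp
  refine ae_eq_zero_of_forall_integral_mul_planeExp hf1 fun ξ => ?_
  -- On the finite measure space D bounded products lie in L^{p'} for every p, so one family of test
  -- products serves all exponents.
  exact integral_mul_planeExp_eq_zero (memLp_two_of_mem_Qa hq₁) (memLp_two_of_mem_Qa hq₂) k hD hf1
    (fun w₁ hw₁ w₂ hw₂ hw => h w₁ hw₁ w₂ hw₂ (hw.mono_exponent le_top)) ξ
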